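/- Let $d\ge 2$ and, for $\eta\in\mathbb R$, let $$W_d^\eta=(1-\eta)\frac{\mathbf I}{d^2}+\eta\,|\psi_+\rangle\langle\psi_+|,\qquad |\psi_+\rangle=\frac1{\sqrt d}\sum_{i=1}^d|i\rangle|i\rangle ,$$ on $\mathbb C^d\otimes\mathbb C^d$ (Alice holds the first factor, Bob the second). An observable is a Hermitian operator $A$ on $\mathbb C^d$; $\lambda(A)$ is its set of eigenvalues and $\Pi^A_a$ the orthogonal projector onto the eigenspace for $a\in\lambda(A)$. A state $W$ is steerable by Alice if there is a set $\mathfrak M$ of observables of Alice for which there do not exist a probability space $(\Xi,\mu)$, a measurable family $(\rho_\xi)_{\xi\in\Xi}$ of states of Bob's system, and functions $\wp(a|A,\xi)$, measurable in $\xi$, that form a probability distribution on $\lambda(A)$ for each $A\in\mathfrak M$ and $\xi\in\Xi$, such that $$\operatorname{Tr}\big[(\Pi_a^A\otimes\Pi_b^B)W\big]=\int_\Xi \wp(a|A,\xi)\,\operatorname{Tr}\big[\Pi_b^B\rho_\xi\big]\,d\mu(\xi)$$ for all $A\in\mathfrak M$, all observables $B$ of Bob, and all $a\in\lambda(A)$,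 $b\in\lambda(B)$. Then for every $\eta$ for which $W_d^\eta$ is a state, i.e. $-\frac1{d^2-1}\le\eta\le1$, the state $W_d^\eta$ is steerable by Alice if and only if $$\eta>\frac{H_d-1}{d-1},\qquad H_d=\sum_{n=1}^d\frac1n .$$ -/

import Mathlib

open MeasureTheory
open scoped Kronecker ComplexOrder

universe u

noncomputable section

namespace Steering

variable {m n : Type} [Fintype m] [DecidableEq m] [Fintype n] [DecidableEq n]

/-- A quantum state: a positive semidefinite matrix of trace one. -/
def IsState (W : Matrix n n ℂ) : Prop :=
  W.PosSemidef ∧ W.trace = 1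

/-- An observable of a system with Hilbert space `ℂⁿ`: a Hermitian matrix. -/
abbrev Observable (n : Type) : Type :=
  {A : Matrix n n ℂ // A.IsHermitian}

/-- The set `λ(A)` of (distinct) eigenvalues of an observable. -/
def Observable.outcomes (A : Observable n) : Finset ℝ :=
  Finset.univ.image A.2.eigenvalues

/-- The set of outcomes is the real spectrum of the matrix. -/
theorem Observable.coe_outcomes (A : Observable n) :
    (A.outcomes : Set ℝ) = spectrum ℝ A.1 := by
  rw [A.2.spectrum_real_eq_range_eigenvalues]
  simp [Observable.outcomes]

/-- The projector `Π_a^A`: the matrix of the orthogonal projection onto the eigenspace of `A`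
for the eigenvalue `a`. -/
def Observable.projector (A : Observable n) (a : ℝ) : Matrix n n ℂ :=
  (Matrix.toEuclideanCLM (n := n) (𝕜 := ℂ)).symm
    (Module.End.eigenspace (Matrix.toEuclideanLin A.1) (a : ℂ)).starProjection

/-- `P(b | B; ρ) = Tr[Π_b^B ρ]`. -/
def prob (B : Observable n) (b : ℝ) (ρ : Matrix n n ℂ) : ℝ :=
  (B.projector b * ρ).trace.re

/-- `P(a, b | A, B; W) = Tr[(Π_a^A ⊗ Π_b^B) W]`. Alice holds the first factor, Bob the second. -/
def jointProb (A : Observable m) (B : Observable n) (a b : ℝ) (W : Matrix (m × n) (m × n) ℂ) :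
    ℝ :=
  ((A.projector a ⊗ₖ B.projector b) * W).trace.re

/-- A local hidden state model for Alice's measurement strategy `M` on the state `W`: an ensemble
of states `ρ ξ` of Bob's system, where `ξ` is distributed according to a probability measure `μ`
on an arbitrary measurable space, together with a probability distribution `p A · ξ` on the
outcomes of `A`, for every `A ∈ M` and every `ξ`, such that
`P(a, b | A, B; W) = ∫ p(a | A, ξ) P(b | B; ρ_ξ) dμ(ξ)` for all `A ∈ M`, all observables `B` of Bob
and all outcomes `a`, `b`. -/
def HasLocalHiddenStateModel (M : Set (Observable m)) (W : Matrix (m × n) (m × n) ℂ) : Prop :=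
  ∃ (Ξ : Type u) (_ : MeasurableSpace Ξ) (μ : Measure Ξ) (ρ : Ξ → Matrix n n ℂ)
    (p : Observable m → ℝ → Ξ → ℝ),
    IsProbabilityMeasure μ ∧
    (∀ ξ, IsState (ρ ξ)) ∧
    (∀ i j, Measurable fun ξ => ρ ξ i j) ∧
    (∀ A ∈ M, ∀ a ∈ A.outcomes, Measurable (p A a)) ∧
    (∀ A ∈ M, ∀ a ∈ A.outcomes, ∀ ξ, 0 ≤ p A a ξ) ∧
    (∀ A ∈ M, ∀ ξ, ∑ a ∈ A.outcomes, p A a ξ = 1) ∧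
    ∀ A ∈ M, ∀ B : Observable n, ∀ a ∈ A.outcomes, ∀ b ∈ B.outcomes,
      jointProb A B a b W = ∫ ξ, p A a ξ * prob B b (ρ ξ) ∂μ

/-- The measurement strategy `M` exhibits steering on `W`. -/
def ExhibitsSteering (M : Set (Observable m)) (W : Matrix (m × n) (m × n) ℂ) : Prop :=
  ¬ HasLocalHiddenStateModel.{u} M W

/-- `W` is steerable by Alice: some measurement strategy of Alice exhibits steering. The universe
parameter is that of the spaces of hidden variables. -/
def SteerableByAlice (W : Matrix (m × n) (m × n) ℂ) : Prop :=
  ∃ M : Set (Observable m), ExhibitsSteering.{u} M W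

/-- The maximally entangled vector `ψ₊ = ∑ᵢ |i⟩|i⟩ / √d`. -/
def maxEntangled (d : ℕ) : Fin d × Fin d → ℂ :=
  fun x => if x.1 = x.2 then ((1 / √(d : ℝ) : ℝ) : ℂ) else 0

/-- The isotropic matrix `(1 - η) I / d² + η P₊`, with `P₊ = |ψ₊⟩⟨ψ₊|`. -/
def isotropic (d : ℕ) (η : ℝ) : Matrix (Fin d × Fin d) (Fin d × Fin d) ℂ :=
  (((1 - η) / (d : ℝ) ^ 2 : ℝ) : ℂ) • (1 : Matrix (Fin d × Fin d) (Fin d × Fin d) ℂ) +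
    (η : ℂ) • Matrix.vecMulVec (maxEntangled d) (star (maxEntangled d))

end Steering

end

/-! Everything rests on one expectation: for a standard complex Gaussian vector `z` in dimension
`d`, the `|z_i|²` are independent exponentials of mean 1, so the mean of `max_i |z_i|²` is `∫ (1 -
(1 - e⁻ᵗ)ᵈ) dt = H_d` (`integral_maxNormSq`).

Below the threshold there is an explicit model. The hidden variable is a uniformly random pure state
of Bob, represented by a Gaussian `z` weighted by `‖z‖²`. If Alice measures the basis `U`, she
reports the index maximizing `|(Uᵀz)_i|`. By symmetry the Gaussian second moments conditioned on her
answer are diagonal, with one entry `H_d / d` and the others equal, which is the isotropic state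
with `η = (H_d - 1) / (d - 1)`. Mixing this answer with a uniform one, with a coefficient `s ≤ 1`
that may be negative, gives the remaining `η` (`hasLocalHiddenStateModel_isotropic`). The inequality
`2d ≤ (d + 1) H_d` ensures that the negative values of `s` reach the least `η` for which the matrix
is a state.

Above the threshold, let Alice use all observables. If she measures the conjugate of Bob's basis
`U`, the two agree with probability `(1 + η(d - 1)) / d`. In a local hidden state model agreement is
at most the mean of the largest outcome probability of `U` in `ρ_ξ`. Averaged over Haar-random `U`,
this largest probability is at most `H_d / d` for every state (`integral_maxOutcomeProb_le`). Hence
`1 + η(d - 1) ≤ H_d`. -/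

namespace Steering

/-! ### Gaussian vectors and the mean of the largest squared modulus -/

/-- The standard complex Gaussian distribution, with density `exp (-|z|²) / π`. -/
noncomputable def complexGaussian : Measure ℂ :=
  volume.withDensity fun z => ENNReal.ofReal (Real.exp (-‖z‖ ^ 2) / Real.pi)

theorem integrable_exp_neg_norm_sq_div_pi :
    Integrable (fun z : ℂ => Real.exp (-‖z‖ ^ 2) / Real.pi) := by
  have h := GaussianFourier.integrable_cexp_neg_mul_sq_norm_add (V := ℂ) (b := 1) (by simp) 0 0
  have h2 := h.norm
  simp only [Complex.norm_exp] at h2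
  refine (h2.div_const Real.pi).congr (Filter.Eventually.of_forall fun z => ?_)
  simp [← Complex.ofReal_pow]

theorem integral_exp_neg_norm_sq_div_pi :
    ∫ z : ℂ, Real.exp (-‖z‖ ^ 2) / Real.pi = 1 := by
  have h := GaussianFourier.integral_rexp_neg_mul_sq_norm (V := ℂ) (b := 1) (by simp)
  rw [integral_div]
  have h3 : ∫ z : ℂ, Real.exp (-‖z‖ ^ 2) = Real.pi := by
    simpa using h
  rw [h3, div_self Real.pi_ne_zero]

theorem complexGaussian_apply {s : Set ℂ} (hs : MeasurableSet s) :
    complexGaussian s = ENNReal.ofReal (∫ z in s, Real.exp (-‖z‖ ^ 2) / Real.pi) := by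
  rw [complexGaussian, withDensity_apply _ hs, ofReal_integral_eq_lintegral_ofReal
    integrable_exp_neg_norm_sq_div_pi.integrableOn]
  exact Filter.Eventually.of_forall fun z => by dsimp; positivity

instance : IsProbabilityMeasure complexGaussian :=
  ⟨by rw [complexGaussian_apply MeasurableSet.univ, setIntegral_univ,
    integral_exp_neg_norm_sq_div_pi, ENNReal.ofReal_one]⟩

/-- In polar coordinates the density of `‖z‖²` becomes that of the exponential law of mean 1. -/
theorem complexGaussian_lt_norm_sq {t : ℝ} (ht : 0 ≤ t) :
    complexGaussian {z | t < ‖z‖ ^ 2} = ENNReal.ofReal (Real.exp (-t)) := by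
  have hm : MeasurableSet {z : ℂ | t < ‖z‖ ^ 2} :=
    measurableSet_lt measurable_const (by fun_prop)
  rw [complexGaussian_apply hm]
  congr 1
  rw [← integral_indicator hm]
  have h := integral_fun_norm_addHaar (volume : Measure ℂ)
    (fun y : ℝ => {y : ℝ | t < y ^ 2}.indicator (fun y => Real.exp (-y ^ 2) / Real.pi) y)
  have e : ∀ z : ℂ, {z : ℂ | t < ‖z‖ ^ 2}.indicator (fun z => Real.exp (-‖z‖ ^ 2) / Real.pi) z =
    {y : ℝ | t < y ^ 2}.indicator (fun y => Real.exp (-y ^ 2) / Real.pi) ‖z‖ := fun z => by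
    simp [Set.indicator]
  rw [integral_congr_ae (Filter.Eventually.of_forall e), h]
  have e2 : ∀ y ∈ Set.Ioi (0 : ℝ), y ^ (Module.finrank ℝ ℂ - 1) •
      {y : ℝ | t < y ^ 2}.indicator (fun y => Real.exp (-y ^ 2) / Real.pi) y =
      (Set.Ioi √t).indicator (fun y => y * Real.exp (-y ^ 2) / Real.pi) y := by
    intro y hy
    have : t < y ^ 2 ↔ √t < y := (Real.sqrt_lt' hy).symm
    simp only [Set.indicator, Set.mem_ofPred_eq, this, Set.mem_Ioi, Complex.finrank_real_complex]
    split_ifs <;> simp [mul_div_assoc]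
  rw [setIntegral_congr_fun measurableSet_Ioi e2, setIntegral_indicator measurableSet_Ioi,
    Set.Ioi_inter_Ioi, sup_eq_right.2 (Real.sqrt_nonneg t)]
  have hd : ∀ y ∈ Set.Ici √t, HasDerivAt (fun y : ℝ => -(Real.exp (-y ^ 2) / (2 * Real.pi)))
      (y * Real.exp (-y ^ 2) / Real.pi) y := by
    intro y _
    have h1 : HasDerivAt (fun y : ℝ => -y ^ 2) (-(2 * y)) y := by
      simpa using (hasDerivAt_pow 2 y).fun_neg
    refine (h1.exp.div_const (2 * Real.pi)).fun_neg.congr_deriv ?_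
    have := Real.pi_ne_zero
    field_simp
  have hlim : Filter.Tendsto (fun y : ℝ => -(Real.exp (-y ^ 2) / (2 * Real.pi))) Filter.atTop
      (nhds 0) := by
    have : Filter.Tendsto (fun y : ℝ => Real.exp (-y ^ 2)) Filter.atTop (nhds 0) :=
      Real.tendsto_exp_neg_atTop_nhds_zero.comp (Filter.tendsto_pow_atTop two_ne_zero)
    simpa using (this.div_const (2 * Real.pi)).neg
  rw [integral_Ioi_of_hasDerivAt_of_nonneg' hd (fun y hy => ?_) hlim]
  -- The polar constant is dimension times the area of the unit disc, `2π`, and cancels the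
  -- denominator of the antiderivative.
  · have hb : volume.real (Metric.ball (0 : ℂ) 1) = Real.pi := by
      simp [Measure.real]
    rw [hb, Complex.finrank_real_complex, Real.sq_sqrt ht]
    have := Real.pi_pos
    simp only [smul_eq_mul, nsmul_eq_mul]
    field_simp
    simp [mul_comm]
  · have : 0 < y := (Real.sqrt_nonneg t).trans_lt hy
    positivity

theorem lintegral_complexGaussian_norm_sq :
    ∫⁻ z, ENNReal.ofReal (‖z‖ ^ 2) ∂complexGaussian = 1 := by
  rw [lintegral_eq_lintegral_meas_lt _ (Filter.Eventually.of_forall fun z => by dsimp; positivity)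
    (by fun_prop), setLIntegral_congr_fun measurableSet_Ioi
      (fun t ht => complexGaussian_lt_norm_sq (le_of_lt ht)),
    ← ofReal_integral_eq_lintegral_ofReal]
  · rw [integral_exp_neg_Ioi]; simp
  · exact integrableOn_exp_neg_Ioi 0
  · exact Filter.Eventually.of_forall fun t => (Real.exp_pos _).le

theorem integrable_norm_sq_complexGaussian :
    Integrable (fun z : ℂ => ‖z‖ ^ 2) complexGaussian := by
  refine ⟨by fun_prop, ?_⟩
  rw [hasFiniteIntegral_iff_ofReal (Filter.Eventually.of_forall fun z => by dsimp; positivity),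
    lintegral_complexGaussian_norm_sq]
  simp

theorem integral_norm_sq_complexGaussian : ∫ z, ‖z‖ ^ 2 ∂complexGaussian = 1 := by
  rw [integral_eq_lintegral_of_nonneg_ae (Filter.Eventually.of_forall fun z => by dsimp; positivity)
    (by fun_prop), lintegral_complexGaussian_norm_sq]
  simp

variable (n : Type) [Fintype n]

/-- The standard Gaussian distribution on `ℂⁿ`. -/
noncomputable def gaussian : Measure (n → ℂ) := Measure.pi fun _ => complexGaussian

instance : IsProbabilityMeasure (gaussian n) := by unfold gaussian; infer_instance

variable {n}

/-- The density depends on `z` only through `∑ i, ‖z i‖ ^ 2`; this is the source of unitary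
invariance. -/
theorem gaussian_eq_withDensity :
    gaussian n = volume.withDensity fun z =>
      ENNReal.ofReal (Real.exp (-∑ i, ‖z i‖ ^ 2) / Real.pi ^ Fintype.card n) := by
  have e : ∀ z : n → ℂ, Real.exp (-∑ i, ‖z i‖ ^ 2) / Real.pi ^ Fintype.card n =
      ∏ i, Real.exp (-‖z i‖ ^ 2) / Real.pi := fun z => by
    rw [Finset.prod_div_distrib, ← Real.exp_sum, Finset.sum_neg_distrib]; simp
  simp_rw [e]
  refine Measure.pi_eq fun s hs => ?_
  rw [withDensity_apply _ (MeasurableSet.univ_pi hs), volume_pi, Measure.restrict_pi_pi,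
    ← ofReal_integral_eq_lintegral_ofReal]
  · rw [integral_fintype_prod_eq_prod (f := fun (_ : n) (z : ℂ) => Real.exp (-‖z‖ ^ 2) / Real.pi),
      ENNReal.ofReal_prod_of_nonneg fun i _ => integral_nonneg fun z => by positivity]
    exact Finset.prod_congr rfl fun i _ => (complexGaussian_apply (hs i)).symm
  · exact Integrable.fintype_prod (f := fun (_ : n) (z : ℂ) => Real.exp (-‖z‖ ^ 2) / Real.pi)
      fun i => integrable_exp_neg_norm_sq_div_pi.integrableOn
  · exact Filter.Eventually.of_forall fun z => Finset.prod_nonneg fun i _ => by positivity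

theorem sum_norm_sq_unitary_mulVec [DecidableEq n] {U : Matrix n n ℂ} (hU : U ∈ Matrix.unitaryGroup n ℂ)
    (z : n → ℂ) : ∑ i, ‖(U.mulVec z) i‖ ^ 2 = ∑ i, ‖z i‖ ^ 2 := by
  have key : ∀ w : n → ℂ, ((∑ i, ‖w i‖ ^ 2 : ℝ) : ℂ) = star w ⬝ᵥ w := fun w => by
    simp [dotProduct, Complex.conj_mul']
  have h : star (U.mulVec z) ⬝ᵥ (U.mulVec z) = star z ⬝ᵥ z := by
    rw [Matrix.star_mulVec, ← Matrix.dotProduct_mulVec, Matrix.mulVec_mulVec,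
      ← Matrix.star_eq_conjTranspose, (Matrix.mem_unitaryGroup_iff').1 hU, Matrix.one_mulVec]
  rw [← key, ← key] at h
  exact_mod_cast h

theorem measurable_mulVec (U : Matrix n n ℂ) : Measurable fun z : n → ℂ => U.mulVec z :=
  (Continuous.matrix_mulVec continuous_const continuous_id).measurable

theorem measurePreserving_unitary_mulVec_volume [DecidableEq n] {U : Matrix n n ℂ}
    (hU : U ∈ Matrix.unitaryGroup n ℂ) :
    MeasurePreserving (fun z : n → ℂ => U.mulVec z) volume volume := by
  refine ⟨measurable_mulVec U, ?_⟩
  let f : (n → ℂ) →ₗ[ℝ] (n → ℂ) := (Matrix.toLin' U).restrictScalars ℝ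
  have hdet : |LinearMap.det f| = 1 := by
    -- The real determinant of a complex linear map is the squared modulus of its complex
    -- determinant.
    have : LinearMap.det f = Algebra.norm ℝ (LinearMap.det (Matrix.toLin' U)) :=
      LinearMap.det_restrictScalars
    rw [this, LinearMap.det_toLin', Algebra.norm_complex_eq]
    have h := (Matrix.det_of_mem_unitary hU)
    have h2 := CStarRing.norm_of_mem_unitary h
    simp [Complex.normSq_eq_norm_sq, h2]
  have hne : LinearMap.det f ≠ 0 := fun h => by simp [h] at hdet
  have := Measure.map_linearMap_addHaar_eq_smul_addHaar (volume : Measure (n → ℂ)) hne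
  rw [abs_inv, hdet] at this
  rw [inv_one, ENNReal.ofReal_one, one_smul] at this
  exact this

theorem measurePreserving_unitary_mulVec [DecidableEq n] {U : Matrix n n ℂ} (hU : U ∈ Matrix.unitaryGroup n ℂ) :
    MeasurePreserving (fun z : n → ℂ => U.mulVec z) (gaussian n) (gaussian n) := by
  have hv := measurePreserving_unitary_mulVec_volume hU
  refine ⟨measurable_mulVec U, ?_⟩
  ext s hs
  rw [Measure.map_apply (measurable_mulVec U) hs, gaussian_eq_withDensity,
    withDensity_apply _ hs, withDensity_apply _ (measurable_mulVec U hs),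
    ← hv.setLIntegral_comp_preimage hs (by fun_prop)]
  simp_rw [sum_norm_sq_unitary_mulVec hU]

theorem integral_gaussian_unitary_mulVec {E : Type*} [NormedAddCommGroup E] [NormedSpace ℝ E]
    [DecidableEq n] {U : Matrix n n ℂ} (hU : U ∈ Matrix.unitaryGroup n ℂ) (f : (n → ℂ) → E) :
    ∫ z, f (U.mulVec z) ∂gaussian n = ∫ z, f z ∂gaussian n := by
  refine (measurePreserving_unitary_mulVec hU).integral_comp ?_ f
  have hcont : ∀ V : Matrix n n ℂ, Continuous fun z : n → ℂ => V.mulVec z := fun V =>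
    Continuous.matrix_mulVec continuous_const continuous_id
  -- As a homeomorphism, the action of `U` is a measurable embedding, so `f` needs no measurability
  -- hypothesis.
  let e : (n → ℂ) ≃ₜ (n → ℂ) :=
    { toFun := fun z => U.mulVec z
      invFun := fun z => (star U).mulVec z
      left_inv := fun z => by
        simp [Matrix.mulVec_mulVec, (Matrix.mem_unitaryGroup_iff').1 hU]
      right_inv := fun z => by
        simp [Matrix.mulVec_mulVec, (Matrix.mem_unitaryGroup_iff).1 hU]
      continuous_toFun := hcont U
      continuous_invFun := hcont (star U) }
  exact e.measurableEmbedding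

theorem integrable_norm_sq_gaussian (i : n) :
    Integrable (fun z : n → ℂ => ‖z i‖ ^ 2) (gaussian n) :=
  (measurePreserving_eval (fun _ : n => complexGaussian) i).integrable_comp_of_integrable
    integrable_norm_sq_complexGaussian

theorem integral_norm_sq_gaussian (i : n) : ∫ z, ‖z i‖ ^ 2 ∂gaussian n = 1 := by
  have h := (measurePreserving_eval (fun _ : n => complexGaussian) i)
  rw [← integral_norm_sq_complexGaussian, ← h.map_eq,
    integral_map h.measurable.aemeasurable (by fun_prop)]
  rfl

theorem integrable_sum_norm_sq_gaussian :
    Integrable (fun z : n → ℂ => ∑ i, ‖z i‖ ^ 2) (gaussian n) :=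
  integrable_finsetSum _ fun i _ => integrable_norm_sq_gaussian i

theorem integral_sum_norm_sq_gaussian :
    ∫ z, ∑ i, ‖z i‖ ^ 2 ∂gaussian n = Fintype.card n := by
  rw [integral_finsetSum _ fun i _ => integrable_norm_sq_gaussian i]
  simp [integral_norm_sq_gaussian]

/-- The largest of the squared moduli of the coordinates. -/
noncomputable def maxNormSq (z : n → ℂ) : ℝ := ⨆ i, ‖z i‖ ^ 2

theorem norm_sq_le_maxNormSq (z : n → ℂ) (i : n) : ‖z i‖ ^ 2 ≤ maxNormSq z :=
  le_ciSup (f := fun i => ‖z i‖ ^ 2) (Set.finite_range _).bddAbove i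

theorem maxNormSq_nonneg {m : Type} (z : m → ℂ) : 0 ≤ maxNormSq z :=
  Real.iSup_nonneg fun _ => by positivity

theorem maxNormSq_le_sum (z : n → ℂ) : maxNormSq z ≤ ∑ i, ‖z i‖ ^ 2 :=
  Real.iSup_le (fun i => Finset.single_le_sum (f := fun i => ‖z i‖ ^ 2)
    (fun _ _ => by positivity) (Finset.mem_univ i)) (Finset.sum_nonneg fun _ _ => by positivity)

theorem measurable_maxNormSq : Measurable (maxNormSq (n := n)) :=
  Measurable.iSup fun i => by fun_prop

theorem integrable_maxNormSq : Integrable maxNormSq (gaussian n) :=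
  integrable_sum_norm_sq_gaussian.mono' measurable_maxNormSq.aestronglyMeasurable <|
    Filter.Eventually.of_forall fun z => by
      rw [Real.norm_of_nonneg (maxNormSq_nonneg z)]; exact maxNormSq_le_sum z

/-- By independence: the maximum is at most `t` exactly when every coordinate is, a product event.
-/
theorem gaussian_real_lt_maxNormSq [Nonempty n] {t : ℝ} (ht : 0 ≤ t) :
    (gaussian n).real {z | t < maxNormSq z} = 1 - (1 - Real.exp (-t)) ^ Fintype.card n := by
  have hs : {z : n → ℂ | t < maxNormSq z} = (Set.univ.pi fun _ => {z : ℂ | t < ‖z‖ ^ 2}ᶜ)ᶜ := by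
    ext z
    simp [maxNormSq, lt_ciSup_iff (Set.finite_range fun i => ‖z i‖ ^ 2).bddAbove]
  have hm : MeasurableSet {z : ℂ | t < ‖z‖ ^ 2} :=
    measurableSet_lt measurable_const (by fun_prop)
  have h1 : complexGaussian.real {z : ℂ | t < ‖z‖ ^ 2}ᶜ = 1 - Real.exp (-t) := by
    rw [probReal_compl_eq_one_sub hm, Measure.real, complexGaussian_lt_norm_sq ht,
      ENNReal.toReal_ofReal (Real.exp_pos _).le]
  rw [hs, probReal_compl_eq_one_sub (MeasurableSet.univ_pi fun _ => hm.compl)]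
  rw [Measure.real, gaussian, Measure.pi_pi, ENNReal.toReal_prod]
  simp only [Measure.real] at h1
  simp [h1]

/-- A geometric sum splits the integrand into terms `e⁻ᵗ (1 - e⁻ᵗ)ᵏ`, each the derivative of `(1 -
e⁻ᵗ)ᵏ⁺¹ / (k + 1)` and so contributing `1 / (k + 1)`. -/
theorem integral_Ioi_one_sub_one_sub_exp_pow (d : ℕ) :
    IntegrableOn (fun t : ℝ => 1 - (1 - Real.exp (-t)) ^ d) (Set.Ioi 0) ∧
    ∫ t in Set.Ioi (0 : ℝ), (1 - (1 - Real.exp (-t)) ^ d) = harmonic d := by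
  have hd : ∀ k : ℕ, ∀ t ∈ Set.Ici (0 : ℝ),
      HasDerivAt (fun t : ℝ => (1 - Real.exp (-t)) ^ (k + 1) / (k + 1))
        (Real.exp (-t) * (1 - Real.exp (-t)) ^ k) t := by
    intro k t _
    have h1 : HasDerivAt (fun t : ℝ => 1 - Real.exp (-t)) (Real.exp (-t)) t := by
      simpa using ((hasDerivAt_neg t).exp.const_sub 1)
    refine ((h1.fun_pow (k + 1)).div_const ((k : ℝ) + 1)).congr_deriv ?_
    have : (k : ℝ) + 1 ≠ 0 := by positivity
    push_cast
    field_simp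
  have hlim : ∀ k : ℕ, Filter.Tendsto (fun t : ℝ => (1 - Real.exp (-t)) ^ (k + 1) / ((k : ℝ) + 1))
      Filter.atTop (nhds (1 / (k + 1))) := by
    intro k
    simpa using ((Real.tendsto_exp_neg_atTop_nhds_zero.const_sub 1).pow (k + 1)).div_const
      ((k : ℝ) + 1)
  have hpos : ∀ k : ℕ, ∀ t ∈ Set.Ioi (0 : ℝ),
      0 ≤ Real.exp (-t) * (1 - Real.exp (-t)) ^ k := by
    intro k t ht
    have : Real.exp (-t) ≤ 1 := Real.exp_le_one_iff.2 (by simpa using (le_of_lt ht))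
    have := sub_nonneg.2 this
    positivity
  have hi : ∀ k : ℕ, IntegrableOn (fun t => Real.exp (-t) * (1 - Real.exp (-t)) ^ k)
      (Set.Ioi (0 : ℝ)) := fun k => integrableOn_Ioi_deriv_of_nonneg' (hd k) (hpos k) (hlim k)
  have e : ∀ t : ℝ, 1 - (1 - Real.exp (-t)) ^ d =
      ∑ k ∈ Finset.range d, Real.exp (-t) * (1 - Real.exp (-t)) ^ k := by
    intro t
    rw [← Finset.mul_sum]
    have := mul_neg_geom_sum (1 - Real.exp (-t)) d
    rw [← this]; ring
  simp_rw [e]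
  refine ⟨integrable_finsetSum _ fun k _ => hi k, ?_⟩
  rw [integral_finsetSum _ fun k _ => hi k, harmonic]
  push_cast
  refine Finset.sum_congr rfl fun k _ => ?_
  rw [integral_Ioi_of_hasDerivAt_of_nonneg' (hd k) (hpos k) (hlim k)]
  simp

theorem integral_maxNormSq [Nonempty n] :
    ∫ z, maxNormSq z ∂gaussian n = harmonic (Fintype.card n) := by
  rw [integrable_maxNormSq.integral_eq_integral_meas_lt
    (Filter.Eventually.of_forall maxNormSq_nonneg), setIntegral_congr_fun measurableSet_Ioi
      (fun t ht => gaussian_real_lt_maxNormSq (le_of_lt ht)),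
    (integral_Ioi_one_sub_one_sub_exp_pow _).2]

end Steering

/-! ### The argmax response and its second moments -/

namespace Steering

variable {n : Type} [Fintype n]

open Classical in
/-- The uniform probability distribution on the coordinates of maximal modulus. -/
noncomputable def argmaxWeight (z : n → ℂ) (i : n) : ℝ :=
  (if ‖z i‖ ^ 2 = maxNormSq z then 1 else 0) /
    ∑ j, if ‖z j‖ ^ 2 = maxNormSq z then 1 else 0

theorem argmaxWeight_nonneg (z : n → ℂ) (i : n) : 0 ≤ argmaxWeight z i := by
  unfold argmaxWeight
  refine div_nonneg ?_ (Finset.sum_nonneg fun j _ => ?_) <;> split_ifs <;> simp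

theorem exists_norm_sq_eq_maxNormSq [Nonempty n] (z : n → ℂ) : ∃ i, ‖z i‖ ^ 2 = maxNormSq z :=
  exists_eq_ciSup_of_finite

theorem sum_argmaxWeight [Nonempty n] (z : n → ℂ) : ∑ i, argmaxWeight z i = 1 := by
  classical
  obtain ⟨i, hi⟩ := exists_norm_sq_eq_maxNormSq z
  unfold argmaxWeight
  rw [← Finset.sum_div]
  refine div_self (ne_of_gt (Finset.sum_pos' (fun j _ => ?_) ⟨i, Finset.mem_univ i, ?_⟩))
  · split_ifs <;> simp
  · simp [hi]

theorem argmaxWeight_le_one [Nonempty n] (z : n → ℂ) (i : n) : argmaxWeight z i ≤ 1 := by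
  rw [← sum_argmaxWeight z]
  exact Finset.single_le_sum (fun j _ => argmaxWeight_nonneg z j) (Finset.mem_univ i)

theorem sum_argmaxWeight_mul_norm_sq [Nonempty n] (z : n → ℂ) :
    ∑ i, argmaxWeight z i * ‖z i‖ ^ 2 = maxNormSq z := by
  have h : ∀ i, argmaxWeight z i * ‖z i‖ ^ 2 = argmaxWeight z i * maxNormSq z := fun i => by
    by_cases hi : ‖z i‖ ^ 2 = maxNormSq z
    · rw [hi]
    · simp [argmaxWeight, hi]
  rw [Finset.sum_congr rfl fun i _ => h i, ← Finset.sum_mul, sum_argmaxWeight, one_mul]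

theorem measurable_argmaxWeight (i : n) : Measurable fun z : n → ℂ => argmaxWeight z i := by
  have h : ∀ j : n, Measurable fun z : n → ℂ =>
      @ite ℝ (‖z j‖ ^ 2 = maxNormSq z) (Classical.propDecidable _) 1 0 := fun j =>
    Measurable.ite (measurableSet_eq_fun (by fun_prop) measurable_maxNormSq) measurable_const
      measurable_const
  exact (h i).div (Finset.measurable_sum _ fun j _ => h j)

theorem argmaxWeight_congr_norm {z w : n → ℂ} (h : ∀ i, ‖z i‖ = ‖w i‖) (i : n) :
    argmaxWeight z i = argmaxWeight w i := by
  have hm : maxNormSq z = maxNormSq w := by simp only [maxNormSq, h]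
  unfold argmaxWeight
  exact congrArg₂ (· / ·) (if_congr (by rw [h, hm]) rfl rfl)
    (Finset.sum_congr rfl fun j _ => if_congr (by rw [h, hm]) rfl rfl)

theorem maxNormSq_comp_perm {m : Type} (σ : Equiv.Perm m) (z : m → ℂ) :
    maxNormSq (z ∘ σ) = maxNormSq z :=
  σ.iSup_comp (g := fun i => ‖z i‖ ^ 2)

/-- Sharing ties equally makes this hold at every `z`, so ties need not be shown to be negligible.
-/
theorem argmaxWeight_comp_perm (σ : Equiv.Perm n) (z : n → ℂ) (i : n) :
    argmaxWeight (z ∘ σ) i = argmaxWeight z (σ i) := by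
  classical
  unfold argmaxWeight
  rw [maxNormSq_comp_perm,
    ← Equiv.sum_comp σ fun j => if ‖z j‖ ^ 2 = maxNormSq z then (1 : ℝ) else 0]
  simp

theorem integrable_mul_star_gaussian (j k : n) :
    Integrable (fun z : n → ℂ => z j * star (z k)) (gaussian n) := by
  refine ((integrable_norm_sq_gaussian j).add (integrable_norm_sq_gaussian k)).mono'
    (by fun_prop) (Filter.Eventually.of_forall fun z => ?_)
  simp only [norm_mul, norm_star, Pi.add_apply]
  nlinarith [sq_nonneg (‖z j‖ - ‖z k‖), sq_nonneg (‖z j‖), sq_nonneg (‖z k‖)]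

theorem integrable_argmaxWeight_mul [Nonempty n] (i j k : n) :
    Integrable (fun z : n → ℂ => (argmaxWeight z i : ℂ) * (z j * star (z k))) (gaussian n) := by
  refine (integrable_mul_star_gaussian j k).bdd_mul (c := 1)
    (Complex.measurable_ofReal.comp (measurable_argmaxWeight i)).aestronglyMeasurable
    (Filter.Eventually.of_forall fun z => ?_)
  rw [Complex.norm_real, Real.norm_of_nonneg (argmaxWeight_nonneg z i)]
  exact argmaxWeight_le_one z i

theorem integrable_argmaxWeight_mul_norm_sq [Nonempty n] (i j : n) :
    Integrable (fun z : n → ℂ => argmaxWeight z i * ‖z j‖ ^ 2) (gaussian n) := by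
  refine (integrable_norm_sq_gaussian j).bdd_mul (c := 1)
    (measurable_argmaxWeight i).aestronglyMeasurable
    (Filter.Eventually.of_forall fun z => ?_)
  rw [Real.norm_of_nonneg (argmaxWeight_nonneg z i)]
  exact argmaxWeight_le_one z i

theorem permMatrix_mem_unitaryGroup [DecidableEq n] (σ : Equiv.Perm n) :
    σ.permMatrix ℂ ∈ Matrix.unitaryGroup n ℂ := by
  rw [Matrix.mem_unitaryGroup_iff, Matrix.star_eq_conjTranspose, Matrix.conjTranspose_permMatrix,
    ← Matrix.permMatrix_mul]
  simp

theorem integral_gaussian_comp_perm {E : Type*} [NormedAddCommGroup E] [NormedSpace ℝ E]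
    (σ : Equiv.Perm n) (f : (n → ℂ) → E) :
    ∫ z, f (z ∘ σ) ∂gaussian n = ∫ z, f z ∂gaussian n := by
  classical
  rw [← integral_gaussian_unitary_mulVec (permMatrix_mem_unitaryGroup σ) f]
  simp_rw [Matrix.permMatrix_mulVec]

theorem integral_argmaxWeight_mul_norm_sq_perm (σ : Equiv.Perm n) (i j : n) :
    ∫ z, argmaxWeight z (σ i) * ‖z (σ j)‖ ^ 2 ∂gaussian n =
      ∫ z, argmaxWeight z i * ‖z j‖ ^ 2 ∂gaussian n := by
  rw [← integral_gaussian_comp_perm σ fun z => argmaxWeight z i * ‖z j‖ ^ 2]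
  simp_rw [argmaxWeight_comp_perm, Function.comp_apply]

/-- These integrals are equal for all `i` by exchangeability, and they add up to the mean of the
maximum. -/
theorem integral_argmaxWeight_mul_norm_sq_self [Nonempty n] (i : n) :
    ∫ z, argmaxWeight z i * ‖z i‖ ^ 2 ∂gaussian n =
      harmonic (Fintype.card n) / Fintype.card n := by
  classical
  have h : ∀ j, ∫ z, argmaxWeight z j * ‖z j‖ ^ 2 ∂gaussian n =
      ∫ z, argmaxWeight z i * ‖z i‖ ^ 2 ∂gaussian n := fun j => by
    simpa using integral_argmaxWeight_mul_norm_sq_perm (Equiv.swap i j) i i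
  have hs := integral_maxNormSq (n := n)
  simp_rw [← sum_argmaxWeight_mul_norm_sq] at hs
  rw [integral_finsetSum _ fun j _ => integrable_argmaxWeight_mul_norm_sq j j,
    Finset.sum_congr rfl fun j _ => h j, Finset.sum_const, Finset.card_univ, nsmul_eq_mul] at hs
  rw [← hs, mul_div_cancel_left₀]
  exact_mod_cast Fintype.card_ne_zero

/-- The weights sum to 1, so the integrals over all `i` add up to `E|z_j|² = 1`. Remove the term `i
= j`; the other `d - 1` are equal by swaps fixing `j`. -/
theorem integral_argmaxWeight_mul_norm_sq_of_ne [Nontrivial n] {i j : n} (hij : i ≠ j) :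
    ∫ z, argmaxWeight z i * ‖z j‖ ^ 2 ∂gaussian n =
      (1 - harmonic (Fintype.card n) / Fintype.card n) / (Fintype.card n - 1) := by
  classical
  have h : ∀ k ∈ Finset.univ.erase j, ∫ z, argmaxWeight z k * ‖z j‖ ^ 2 ∂gaussian n =
      ∫ z, argmaxWeight z i * ‖z j‖ ^ 2 ∂gaussian n := fun k hk => by
    simpa [Equiv.swap_apply_of_ne_of_ne hij.symm (Finset.ne_of_mem_erase hk).symm] using
      integral_argmaxWeight_mul_norm_sq_perm (Equiv.swap i k) i j
  have hs := integral_norm_sq_gaussian j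
  have e : ∀ z : n → ℂ, ‖z j‖ ^ 2 = ∑ k, argmaxWeight z k * ‖z j‖ ^ 2 := fun z => by
    rw [← Finset.sum_mul, sum_argmaxWeight, one_mul]
  rw [integral_congr_ae (Filter.Eventually.of_forall e),
    integral_finsetSum _ fun k _ => integrable_argmaxWeight_mul_norm_sq k j,
    ← Finset.add_sum_erase _ _ (Finset.mem_univ j), integral_argmaxWeight_mul_norm_sq_self,
    Finset.sum_congr rfl h, Finset.sum_const, Finset.card_erase_of_mem (Finset.mem_univ j),
    Finset.card_univ, nsmul_eq_mul, Nat.cast_sub Fintype.card_pos, Nat.cast_one] at hs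
  have : (1 : ℝ) < Fintype.card n := by exact_mod_cast Fintype.one_lt_card
  rw [eq_div_iff (by linarith)]
  linear_combination hs

/-- Flipping the sign of the `j`-th coordinate preserves the Gaussian law and all moduli, but
negates the integrand. -/
theorem integral_argmaxWeight_mul_of_ne (i : n) {j k : n} (hjk : j ≠ k) :
    ∫ z, (argmaxWeight z i : ℂ) * (z j * star (z k)) ∂gaussian n = 0 := by
  classical
  let ε : n → ℂ := fun l => if l = j then -1 else 1
  have hε : ∀ l, ‖ε l‖ = 1 := fun l => by simp only [ε]; split_ifs <;> simp
  have hU : Matrix.diagonal ε ∈ Matrix.unitaryGroup n ℂ := by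
    rw [Matrix.mem_unitaryGroup_iff, Matrix.star_eq_conjTranspose, Matrix.diagonal_conjTranspose,
      Matrix.diagonal_mul_diagonal, ← Matrix.diagonal_one]
    congr 1
    funext l
    simp [Complex.mul_conj', hε]
  have h := integral_gaussian_unitary_mulVec hU
    fun z => (argmaxWeight z i : ℂ) * (z j * star (z k))
  have e : ∀ z : n → ℂ, argmaxWeight ((Matrix.diagonal ε).mulVec z) i = argmaxWeight z i :=
    fun z => argmaxWeight_congr_norm (fun l => by simp [Matrix.mulVec_diagonal, hε]) i
  simp only [e, Matrix.mulVec_diagonal, ε, if_pos, if_neg hjk.symm, neg_mul, one_mul, mul_neg,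
    integral_neg] at h
  exact self_eq_neg.1 h.symm

/-- The second moments of the Gaussian distribution weighted by `argmaxWeight · i`. -/
theorem integral_argmaxWeight_mul [Nontrivial n] [DecidableEq n] (i j k : n) :
    ∫ z, (argmaxWeight z i : ℂ) * (z j * star (z k)) ∂gaussian n =
      if j = k then (if i = j then ((harmonic (Fintype.card n) / Fintype.card n : ℝ) : ℂ)
        else (((1 - harmonic (Fintype.card n) / Fintype.card n) / (Fintype.card n - 1) : ℝ) : ℂ))
      else 0 := by
  split_ifs with hjk hij
  · subst hjk hij
    rw [← integral_argmaxWeight_mul_norm_sq_self i, ← integral_complex_ofReal]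
    simp [Complex.mul_conj']
  · subst hjk
    rw [← integral_argmaxWeight_mul_norm_sq_of_ne hij, ← integral_complex_ofReal]
    simp [Complex.mul_conj']
  · exact integral_argmaxWeight_mul_of_ne i hjk

/-- The random response `argmaxWeight`, mixed with the uniform one. -/
noncomputable def response (s : ℝ) (z : n → ℂ) (i : n) : ℝ :=
  (1 - s) / Fintype.card n + s * argmaxWeight z i

theorem sum_response [Nonempty n] (s : ℝ) (z : n → ℂ) : ∑ i, response s z i = 1 := by
  have : (Fintype.card n : ℝ) ≠ 0 := by exact_mod_cast Fintype.card_ne_zero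
  simp only [response, Finset.sum_add_distrib, ← Finset.mul_sum, sum_argmaxWeight]
  simp
  field_simp
  ring

theorem response_nonneg [Nonempty n] {s : ℝ} (h1 : s ≤ 1)
    (h2 : 0 ≤ 1 + s * (Fintype.card n - 1)) (z : n → ℂ) (i : n) : 0 ≤ response s z i := by
  have hc : (0 : ℝ) < Fintype.card n := by exact_mod_cast Fintype.card_pos
  -- The response is affine in the weight, which lies in `[0, 1]`; the hypotheses bound it at the
  -- two ends. Negative `s`, which disfavours the largest coordinate, serves negative `η`.
  have e : response s z i = ((1 - s) * (1 - argmaxWeight z i) +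
      (1 + s * (Fintype.card n - 1)) * argmaxWeight z i) / Fintype.card n := by
    unfold response
    field_simp
    ring
  rw [e]
  have := argmaxWeight_nonneg z i
  have := sub_nonneg.2 (argmaxWeight_le_one z i)
  have := sub_nonneg.2 h1
  positivity

theorem measurable_response (s : ℝ) (i : n) : Measurable fun z : n → ℂ => response s z i :=
  ((measurable_argmaxWeight i).const_mul s).const_add _

theorem integral_mul_star_gaussian [Nontrivial n] [DecidableEq n] (j k : n) :
    ∫ z, z j * star (z k) ∂gaussian n = if j = k then 1 else 0 := by
  split_ifs with h
  · subst h
    rw [← Complex.ofReal_one, ← integral_norm_sq_gaussian j, ← integral_complex_ofReal]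
    simp [Complex.mul_conj']
  · have e : ∀ z : n → ℂ, z j * star (z k) =
        ∑ i, (argmaxWeight z i : ℂ) * (z j * star (z k)) := fun z => by
      rw [← Finset.sum_mul, ← Complex.ofReal_sum, sum_argmaxWeight, Complex.ofReal_one, one_mul]
    rw [integral_congr_ae (Filter.Eventually.of_forall e),
      integral_finsetSum _ fun i _ => integrable_argmaxWeight_mul i j k]
    exact Finset.sum_eq_zero fun i _ => integral_argmaxWeight_mul_of_ne i h

theorem integrable_response_mul [Nonempty n] (s : ℝ) (i j k : n) :
    Integrable (fun z : n → ℂ => (response s z i : ℂ) * (z j * star (z k))) (gaussian n) := by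
  have := ((integrable_mul_star_gaussian j k).const_mul (((1 - s) / Fintype.card n : ℝ) : ℂ)).add
    ((integrable_argmaxWeight_mul i j k).const_mul (s : ℂ))
  refine this.congr (Filter.Eventually.of_forall fun z => ?_)
  simp only [Pi.add_apply, response]
  push_cast
  ring

/-- For `s = η (d - 1) / (H_d - 1)`, the second moments of the Gaussian distribution weighted by
`response s · i`. -/
theorem integral_response_mul [Nontrivial n] [DecidableEq n] {s η : ℝ}
    (hs : s * (harmonic (Fintype.card n) - 1) = η * (Fintype.card n - 1)) (i j k : n) :
    ∫ z, (response s z i : ℂ) * (z j * star (z k)) ∂gaussian n =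
      if j = k then (((1 - η) / Fintype.card n : ℝ) : ℂ) + (if i = j then (η : ℂ) else 0)
      else 0 := by
  have e : ∀ z : n → ℂ, (response s z i : ℂ) * (z j * star (z k)) =
      (((1 - s) / Fintype.card n : ℝ) : ℂ) * (z j * star (z k)) +
        (s : ℂ) * ((argmaxWeight z i : ℂ) * (z j * star (z k))) := fun z => by
    simp only [response]
    push_cast
    ring
  rw [integral_congr_ae (Filter.Eventually.of_forall e),
    integral_add ((integrable_mul_star_gaussian j k).const_mul _)
      ((integrable_argmaxWeight_mul i j k).const_mul _), integral_const_mul, integral_const_mul,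
    integral_mul_star_gaussian, integral_argmaxWeight_mul]
  have h1 : (1 : ℝ) < Fintype.card n := by exact_mod_cast Fintype.one_lt_card
  have h0 : (Fintype.card n : ℝ) ≠ 0 := by linarith
  have h2 : (Fintype.card n : ℝ) - 1 ≠ 0 := by linarith
  split_ifs
  · rw [mul_one, ← Complex.ofReal_mul, ← Complex.ofReal_add, ← Complex.ofReal_add]
    congr 1
    field_simp
    linear_combination hs
  · rw [mul_one, add_zero, ← Complex.ofReal_mul, ← Complex.ofReal_add]
    congr 1
    field_simp
    linear_combination -hs
  · simp

theorem integrable_response_mul_quadratic [Nonempty n] (s : ℝ) (i : n) (Q : Matrix n n ℂ) :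
    Integrable (fun z : n → ℂ => (response s z i : ℂ) * (star z ⬝ᵥ Q.mulVec z)) (gaussian n) := by
  have : ∀ z : n → ℂ, (response s z i : ℂ) * (star z ⬝ᵥ Q.mulVec z) =
      ∑ k, ∑ j, Q k j * ((response s z i : ℂ) * (z j * star (z k))) := fun z => by
    simp only [dotProduct, Matrix.mulVec, Finset.mul_sum, Pi.star_apply]
    exact Finset.sum_congr rfl fun k _ => Finset.sum_congr rfl fun j _ => by ring
  simp_rw [this]
  exact integrable_finsetSum _ fun k _ => integrable_finsetSum _ fun j _ =>
    (integrable_response_mul s i j k).const_mul _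

theorem integral_response_mul_quadratic [Nontrivial n] [DecidableEq n] {s η : ℝ}
    (hs : s * (harmonic (Fintype.card n) - 1) = η * (Fintype.card n - 1)) (i : n)
    (Q : Matrix n n ℂ) :
    ∫ z, (response s z i : ℂ) * (star z ⬝ᵥ Q.mulVec z) ∂gaussian n =
      (((1 - η) / Fintype.card n : ℝ) : ℂ) * Q.trace + η * Q i i := by
  have : ∀ z : n → ℂ, (response s z i : ℂ) * (star z ⬝ᵥ Q.mulVec z) =
      ∑ k, ∑ j, Q k j * ((response s z i : ℂ) * (z j * star (z k))) := fun z => by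
    simp only [dotProduct, Matrix.mulVec, Finset.mul_sum, Pi.star_apply]
    exact Finset.sum_congr rfl fun k _ => Finset.sum_congr rfl fun j _ => by ring
  simp_rw [this]
  refine (integral_finsetSum _ fun k _ => integrable_finsetSum _ fun j _ =>
    (integrable_response_mul s i j k).const_mul _).trans ?_
  have h2 : ∀ k, ∫ z, ∑ j, Q k j * ((response s z i : ℂ) * (z j * star (z k))) ∂gaussian n =
      (((1 - η) / Fintype.card n : ℝ) : ℂ) * Q k k + if i = k then η * Q k k else 0 := fun k => by
    refine (integral_finsetSum _ fun j _ =>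
      (integrable_response_mul s i j k).const_mul _).trans ?_
    simp_rw [integral_const_mul, integral_response_mul hs]
    rw [Finset.sum_eq_single k (fun j _ hj => by simp [hj]) (by simp)]
    simp only [if_true]
    split_ifs <;> ring
  simp_rw [h2]
  rw [Finset.sum_add_distrib, ← Finset.mul_sum, Matrix.trace]
  simp

/-- The substitution `w = V z` reduces a measurement in any basis to the standard one. -/
theorem integral_response_unitary_mul_quadratic [Nontrivial n] [DecidableEq n] {s η : ℝ}
    (hs : s * (harmonic (Fintype.card n) - 1) = η * (Fintype.card n - 1)) (i : n)
    {V : Matrix n n ℂ} (hV : V ∈ Matrix.unitaryGroup n ℂ) (Q : Matrix n n ℂ) :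
    Integrable (fun z => (response s (V.mulVec z) i : ℂ) * (star z ⬝ᵥ Q.mulVec z)) (gaussian n) ∧
    ∫ z, (response s (V.mulVec z) i : ℂ) * (star z ⬝ᵥ Q.mulVec z) ∂gaussian n =
      (((1 - η) / Fintype.card n : ℝ) : ℂ) * Q.trace + η * (V * Q * star V) i i := by
  have e : ∀ z : n → ℂ, (response s (V.mulVec z) i : ℂ) * (star z ⬝ᵥ Q.mulVec z) =
      (fun w => (response s w i : ℂ) * (star w ⬝ᵥ (V * Q * star V).mulVec w)) (V.mulVec z) := by
    intro z
    have hz : star V * V = 1 := Matrix.mem_unitaryGroup_iff'.1 hV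
    simp only
    congr 1
    rw [Matrix.star_mulVec, ← Matrix.dotProduct_mulVec, Matrix.mulVec_mulVec,
      Matrix.mulVec_mulVec, ← Matrix.star_eq_conjTranspose]
    simp only [← mul_assoc, hz, one_mul]
    rw [mul_assoc, hz, mul_one]
  refine ⟨?_, ?_⟩
  · simp_rw [e]
    exact (measurePreserving_unitary_mulVec hV).integrable_comp_of_integrable
      (integrable_response_mul_quadratic s i _)
  · refine ((integral_congr_ae (Filter.Eventually.of_forall e)).trans
      (integral_gaussian_unitary_mulVec hV fun w : n → ℂ =>
        (response s w i : ℂ) * (star w ⬝ᵥ (V * Q * star V).mulVec w))).trans ?_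
    rw [integral_response_mul_quadratic hs, Matrix.trace_mul_comm, ← mul_assoc,
      Matrix.mem_unitaryGroup_iff'.1 hV, one_mul]

end Steering

/-! ### Spectral projectors and the statistics of the isotropic state -/

namespace Steering

variable {n : Type} [Fintype n] [DecidableEq n]

/-- The spectral projector of a matrix diagonalized by a unitary matrix. -/
theorem Observable.projector_eq (A : Observable n) {U : Matrix n n ℂ}
    (hU : U ∈ Matrix.unitaryGroup n ℂ) {l : n → ℝ}
    (hA : A.1 = U * Matrix.diagonal (fun i => (l i : ℂ)) * star U) (a : ℝ) :
    A.projector a = U * Matrix.diagonal (fun i => if l i = a then 1 else 0) * star U := by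
  set D : Matrix n n ℂ := Matrix.diagonal (fun i => if l i = a then 1 else 0) with hD
  set M := U * D * star U with hM
  have hU1 : star U * U = 1 := Matrix.mem_unitaryGroup_iff'.1 hU
  have hU2 : U * star U = 1 := Matrix.mem_unitaryGroup_iff.1 hU
  have hDD : D * D = D := by simp [hD, Matrix.diagonal_mul_diagonal]
  have hMM : M * M = M := by
    calc M * M = U * D * (star U * U) * D * star U := by simp only [hM, mul_assoc]
      _ = M := by rw [hU1, mul_one, mul_assoc U, hDD]
  have hMs : M.conjTranspose = M := by
    have : D.conjTranspose = D := by
      rw [hD, Matrix.diagonal_conjTranspose]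
      congr 1
      funext i
      simp [apply_ite]
    simp only [hM, Matrix.star_eq_conjTranspose, Matrix.conjTranspose_mul,
      Matrix.conjTranspose_conjTranspose, this, mul_assoc]
  have hAM : A.1 * M = (a : ℂ) • M := by
    have : Matrix.diagonal (fun i => (l i : ℂ)) * D = (a : ℂ) • D := by
      rw [hD, Matrix.diagonal_mul_diagonal, ← Matrix.diagonal_smul]
      congr 1
      funext i
      by_cases h : l i = a <;> simp [h]
    calc A.1 * M = U * (Matrix.diagonal (fun i => (l i : ℂ)) * ((star U * U) * (D * star U))) := by
          simp only [hA, hM, mul_assoc]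
      _ = (a : ℂ) • M := by
          rw [hU1, one_mul, ← mul_assoc (Matrix.diagonal _), this, Matrix.smul_mul, Matrix.mul_smul,
            ← mul_assoc]
  -- In the coordinates given by `U`, an eigenvector for `a` vanishes wherever `l i ≠ a`, so `D`
  -- fixes it.
  have hfix : ∀ w : n → ℂ, A.1.mulVec w = (a : ℂ) • w → M.mulVec w = w := by
    intro w hw
    have h1 : (Matrix.diagonal fun i => (l i : ℂ)).mulVec ((star U).mulVec w) =
        (a : ℂ) • (star U).mulVec w := by
      rw [← Matrix.mulVec_smul, ← hw, hA]
      simp only [Matrix.mulVec_mulVec, ← mul_assoc, hU1, one_mul]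
    have h2 : D.mulVec ((star U).mulVec w) = (star U).mulVec w := by
      funext i
      have := congrFun h1 i
      simp only [Matrix.mulVec_diagonal, Pi.smul_apply, smul_eq_mul] at this
      rw [hD, Matrix.mulVec_diagonal]
      split_ifs with h
      · rw [one_mul]
      · rw [zero_mul]
        by_contra h0
        exact h (by exact_mod_cast mul_right_cancel₀ (Ne.symm h0) this)
    rw [hM, ← Matrix.mulVec_mulVec, ← Matrix.mulVec_mulVec, h2, Matrix.mulVec_mulVec, hU2,
      Matrix.one_mulVec]
  unfold Observable.projector
  rw [← StarAlgEquiv.symm_apply_apply (Matrix.toEuclideanCLM (n := n) (𝕜 := ℂ)) M]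
  congr 1
  ext1 x
  -- `M x` lies in the eigenspace by `hAM`. The residual `x - M x` is orthogonal to it: write `w = M
  -- w`, move the self-adjoint `M` across, and use `M * M = M`.
  refine Submodule.eq_starProjection_of_mem_of_inner_eq_zero ?_ ?_
  · rw [Module.End.mem_eigenspace_iff]
    refine (WithLp.ofLp_injective 2) ?_
    change A.1.mulVec (M.mulVec x.ofLp) = (a : ℂ) • M.mulVec x.ofLp
    rw [Matrix.mulVec_mulVec, hAM, Matrix.smul_mulVec]
  · intro w hw
    rw [Module.End.mem_eigenspace_iff] at hw
    have hw' := hfix w.ofLp (congrArg WithLp.ofLp hw)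
    rw [EuclideanSpace.inner_eq_star_dotProduct]
    change w.ofLp ⬝ᵥ star (x.ofLp - M.mulVec x.ofLp) = 0
    rw [← hw', dotProduct_comm, Matrix.dotProduct_mulVec, ← hMs, ← Matrix.star_mulVec, hMs,
      Matrix.mulVec_sub, Matrix.mulVec_mulVec, hMM, sub_self, star_zero, zero_dotProduct]

theorem Observable.outcomes_eq (A : Observable n) {U : Matrix n n ℂ}
    (hU : U ∈ Matrix.unitaryGroup n ℂ) {l : n → ℝ}
    (hA : A.1 = U * Matrix.diagonal (fun i => (l i : ℂ)) * star U) :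
    A.outcomes = Finset.univ.image l := by
  have h : spectrum ℂ A.1 = Set.range fun i => (l i : ℂ) := by
    rw [hA]
    have := Unitary.spectrum_star_right_conjugate (R := ℂ)
      (a := Matrix.diagonal fun i => (l i : ℂ)) (U := ⟨U, hU⟩)
    exact this.trans (spectrum_diagonal _)
  rw [← Finset.coe_inj, A.coe_outcomes]
  ext a
  rw [← spectrum.algebraMap_mem_iff ℂ, h]
  simp

theorem Observable.exists_diagonalization (A : Observable n) :
    ∃ U ∈ Matrix.unitaryGroup n ℂ, ∃ l : n → ℝ,
      A.1 = U * Matrix.diagonal (fun i => (l i : ℂ)) * star U :=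
  ⟨A.2.eigenvectorUnitary, A.2.eigenvectorUnitary.2, A.2.eigenvalues, by
    conv_lhs => rw [A.2.spectral_theorem, Unitary.conjStarAlgAut_apply]
    rfl⟩

/-- The observable with eigenvectors the columns of `U`, and eigenvalues `l`. -/
def unitaryObservable (U : Matrix n n ℂ) (l : n → ℝ) : Observable n :=
  ⟨U * Matrix.diagonal (fun i => (l i : ℂ)) * star U, by
    refine Matrix.isHermitian_mul_mul_conjTranspose U ?_
    rw [Matrix.IsHermitian, Matrix.diagonal_conjTranspose]
    congr 1
    funext i
    simp⟩

/-- Contraction with `ψ₊` identifies Alice's indices with Bob's, and her operator acts on his side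
as its transpose. This is why transposes and conjugate bases appear below. -/
theorem trace_kronecker_mul_vecMulVec_maxEntangled (d : ℕ)
    (P Q : Matrix (Fin d) (Fin d) ℂ) :
    ((P ⊗ₖ Q) * Matrix.vecMulVec (maxEntangled d) (star (maxEntangled d))).trace =
      (1 / d : ℝ) * (P.transpose * Q).trace := by
  have hd' : (0 : ℝ) ≤ d := Nat.cast_nonneg d
  have h : ((1 / √(d : ℝ) : ℝ) : ℂ) * ((1 / √(d : ℝ) : ℝ) : ℂ) = ((1 / d : ℝ) : ℂ) := by
    rw [← Complex.ofReal_mul, div_mul_div_comm, Real.mul_self_sqrt hd', one_mul]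
  rw [Matrix.trace_mul_comm, Matrix.trace, Finset.sum_congr rfl fun x _ => by
    rw [Matrix.diag_apply, Matrix.mul_apply]]
  simp only [Matrix.vecMulVec_apply, Fintype.sum_prod_type, Matrix.kroneckerMap_apply,
    maxEntangled, Pi.star_apply, Matrix.trace, Matrix.diag_apply, Matrix.mul_apply,
    Matrix.transpose_apply]
  simp only [apply_ite star, star_zero, Complex.star_def, Complex.conj_ofReal, ite_mul, zero_mul,
    mul_ite, mul_zero, Finset.sum_ite_eq, Finset.mem_univ, if_true, h, Finset.mul_sum]
  simp

theorem jointProb_isotropic (d : ℕ) (η : ℝ) (A B : Observable (Fin d)) (a b : ℝ) :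
    jointProb A B a b (isotropic d η) =
      ((((1 - η) / (d : ℝ) ^ 2 : ℝ) : ℂ) * ((A.projector a).trace * (B.projector b).trace) +
        ((η / d : ℝ) : ℂ) * ((A.projector a).transpose * B.projector b).trace).re := by
  unfold jointProb isotropic
  rw [mul_add, Matrix.trace_add, Matrix.mul_smul, Matrix.mul_smul, Matrix.trace_smul,
    Matrix.trace_smul, mul_one, Matrix.trace_kronecker,
    trace_kronecker_mul_vecMulVec_maxEntangled d, smul_eq_mul, smul_eq_mul, ← mul_assoc (η : ℂ),
    ← Complex.ofReal_mul, mul_one_div]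

/-- `ψ₊` is an eigenvector, with eigenvalue `(1 - η) / d² + η`. -/
theorem one_add_mul_nonneg_of_isState_isotropic (d : ℕ) (hd : d ≠ 0) (η : ℝ)
    (h : IsState (isotropic d η)) : 0 ≤ 1 + η * ((d : ℝ) ^ 2 - 1) := by
  have hd' : (0 : ℝ) < d := by positivity
  have h1 := h.1.dotProduct_mulVec_nonneg (maxEntangled d)
  have hn : star (maxEntangled d) ⬝ᵥ maxEntangled d = 1 := by
    have h : ((1 / √(d : ℝ) : ℝ) : ℂ) * ((1 / √(d : ℝ) : ℝ) : ℂ) = ((1 / d : ℝ) : ℂ) := by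
      rw [← Complex.ofReal_mul, div_mul_div_comm, Real.mul_self_sqrt hd'.le, one_mul]
    simp only [dotProduct, Fintype.sum_prod_type, maxEntangled, Pi.star_apply, apply_ite star,
      star_zero, Complex.star_def, Complex.conj_ofReal, ite_mul, zero_mul, mul_ite, mul_zero,
      Finset.sum_ite_eq, Finset.mem_univ, if_true, h]
    simp [hd]
  have e : star (maxEntangled d) ⬝ᵥ (isotropic d η).mulVec (maxEntangled d) =
      (((1 - η) / (d : ℝ) ^ 2 + η : ℝ) : ℂ) := by
    rw [isotropic, Matrix.add_mulVec, Matrix.smul_mulVec, Matrix.smul_mulVec, Matrix.one_mulVec,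
      Matrix.vecMulVec_mulVec, dotProduct_add, dotProduct_smul, dotProduct_smul, hn]
    simp [hn]
  rw [e, Complex.zero_le_real] at h1
  have := mul_nonneg (sq_nonneg (d : ℝ)) h1
  have e2 : (d : ℝ) ^ 2 * ((1 - η) / (d : ℝ) ^ 2 + η) = 1 + η * ((d : ℝ) ^ 2 - 1) := by
    field_simp
    ring
  rwa [e2] at this

end Steering

/-! ### The local hidden state model -/

namespace Steering

variable {m n : Type} [Fintype m] [DecidableEq m] [Fintype n] [DecidableEq n]

/-- The space of hidden variables can be lifted to any universe. -/
theorem HasLocalHiddenStateModel.ulift {M : Set (Observable m)} {W : Matrix (m × n) (m × n) ℂ}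
    (h : HasLocalHiddenStateModel.{0} M W) : HasLocalHiddenStateModel.{u} M W := by
  obtain ⟨Ξ, _, μ, ρ, p, hμ, hρ, hρm, hpm, hp0, hp1, hW⟩ := h
  refine ⟨ULift.{u} Ξ, inferInstance, μ.map MeasurableEquiv.ulift.symm, fun ξ => ρ ξ.down,
    fun A a ξ => p A a ξ.down, ?_, fun ξ => hρ _, fun i j => (hρm i j).comp measurable_down,
    fun A hA a ha => (hpm A hA a ha).comp measurable_down, fun A hA a ha ξ => hp0 A hA a ha _,
    fun A hA ξ => hp1 A hA _, fun A hA B a ha b hb => ?_⟩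
  · exact Measure.isProbabilityMeasure_map MeasurableEquiv.ulift.symm.measurable.aemeasurable
  · rw [hW A hA B a ha b hb, integral_map_equiv]
    rfl

/-- The normalized pure state of a vector (and the maximally mixed state for the zero vector). -/
noncomputable def pureState (z : n → ℂ) : Matrix n n ℂ :=
  open Classical in
  if z = 0 then (((Fintype.card n : ℝ)⁻¹ : ℝ) : ℂ) • 1
  else (((∑ i, ‖z i‖ ^ 2)⁻¹ : ℝ) : ℂ) • Matrix.vecMulVec z (star z)

theorem sum_norm_sq_pos {m : Type} [Fintype m] {z : m → ℂ} (hz : z ≠ 0) : 0 < ∑ i, ‖z i‖ ^ 2 := by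
  obtain ⟨i, hi⟩ := Function.ne_iff.1 hz
  exact Finset.sum_pos' (fun _ _ => by positivity) ⟨i, Finset.mem_univ i, by
    have := norm_pos_iff.2 hi
    positivity⟩

theorem isState_pureState [Nonempty n] (z : n → ℂ) : IsState (pureState z) := by
  unfold pureState
  split_ifs with hz
  · refine ⟨Matrix.PosSemidef.one.smul ?_, ?_⟩
    · rw [Complex.zero_le_real]; positivity
    · simp
  · have h := sum_norm_sq_pos hz
    refine ⟨(Matrix.posSemidef_vecMulVec_self_star z).smul ?_, ?_⟩
    · rw [Complex.zero_le_real]; positivity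
    · rw [Matrix.trace_smul, Matrix.trace_vecMulVec]
      have : z ⬝ᵥ star z = ((∑ i, ‖z i‖ ^ 2 : ℝ) : ℂ) := by
        simp [dotProduct, Complex.mul_conj']
      rw [this, smul_eq_mul, ← Complex.ofReal_mul, inv_mul_cancel₀ h.ne', Complex.ofReal_one]

theorem measurable_pureState (i j : n) : Measurable fun z : n → ℂ => pureState z i j := by
  have e : (fun z : n → ℂ => pureState z i j) = fun z =>
      @ite ℂ (z = 0) (Classical.propDecidable _)
        (((((Fintype.card n : ℝ)⁻¹ : ℝ) : ℂ) • (1 : Matrix n n ℂ)) i j)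
        ((((∑ i, ‖z i‖ ^ 2)⁻¹ : ℝ) : ℂ) * (z i * star (z j))) := by
    funext z
    unfold pureState
    split_ifs <;> rfl
  rw [e]
  refine Measurable.ite (measurableSet_singleton 0) measurable_const ?_
  fun_prop

/-- The factor clears the normalization, and at `z = 0` both sides vanish whatever state is assigned
there. Thus the weight in `hiddenMeasure` leaves plain Gaussian quadratic moments. -/
theorem sum_norm_sq_mul_prob_pureState (B : Observable n) (b : ℝ) (z : n → ℂ) :
    (∑ i, ‖z i‖ ^ 2) * prob B b (pureState z) = (star z ⬝ᵥ (B.projector b).mulVec z).re := by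
  unfold pureState prob
  split_ifs with hz
  · simp [hz]
  · have h := (sum_norm_sq_pos hz).ne'
    rw [Matrix.mul_smul, Matrix.trace_smul, Matrix.mul_vecMulVec, Matrix.trace_vecMulVec,
      smul_eq_mul, Complex.re_ofReal_mul, mul_inv_cancel_left₀ h, dotProduct_comm]

theorem transpose_mem_unitaryGroup {U : Matrix n n ℂ} (hU : U ∈ Matrix.unitaryGroup n ℂ) :
    U.transpose ∈ Matrix.unitaryGroup n ℂ := by
  rw [Matrix.mem_unitaryGroup_iff]
  have h := congrArg Matrix.transpose (Matrix.mem_unitaryGroup_iff'.1 hU)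
  rwa [Matrix.transpose_mul, Matrix.transpose_one] at h

theorem trace_transpose_mul_eq_sum {U : Matrix n n ℂ} (D : n → ℂ) (Q : Matrix n n ℂ) :
    ((U * Matrix.diagonal D * star U).transpose * Q).trace =
      ∑ i, D i * (U.transpose * Q * star U.transpose) i i := by
  have e : (U * Matrix.diagonal D * star U).transpose =
      star U.transpose * (Matrix.diagonal D * U.transpose) := by
    rw [Matrix.transpose_mul, Matrix.transpose_mul, Matrix.diagonal_transpose]
    rfl
  rw [e, mul_assoc, Matrix.trace_mul_comm, mul_assoc, mul_assoc, ← mul_assoc U.transpose]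
  simp [Matrix.trace, Matrix.diagonal_mul]

theorem trace_unitary_conj_diagonal {U : Matrix n n ℂ} (hU : U ∈ Matrix.unitaryGroup n ℂ)
    (D : n → ℂ) : (U * Matrix.diagonal D * star U).trace = ∑ i, D i := by
  rw [Matrix.trace_mul_comm, ← mul_assoc, Matrix.mem_unitaryGroup_iff'.1 hU, one_mul,
    Matrix.trace_diagonal]

/-- The Gaussian distribution with density proportional to the squared norm. -/
noncomputable def hiddenMeasure (n : Type) [Fintype n] : Measure (n → ℂ) :=
  (gaussian n).withDensity fun z => ENNReal.ofReal ((∑ i, ‖z i‖ ^ 2) / Fintype.card n)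

theorem isProbabilityMeasure_hiddenMeasure {m : Type} [Fintype m] [Nonempty m] :
    IsProbabilityMeasure (hiddenMeasure m) := by
  refine ⟨?_⟩
  have : (Fintype.card m : ℝ) ≠ 0 := by exact_mod_cast Fintype.card_ne_zero
  rw [hiddenMeasure, withDensity_apply _ MeasurableSet.univ, setLIntegral_univ,
    ← ofReal_integral_eq_lintegral_ofReal (integrable_sum_norm_sq_gaussian.div_const _)
      (Filter.Eventually.of_forall fun z => by dsimp; positivity), integral_div,
    integral_sum_norm_sq_gaussian, div_self this, ENNReal.ofReal_one]

theorem integral_hiddenMeasure_mul_prob (B : Observable n) (b : ℝ) (f : (n → ℂ) → ℝ) :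
    ∫ z, f z * prob B b (pureState z) ∂hiddenMeasure n =
      ∫ z, (f z * (star z ⬝ᵥ (B.projector b).mulVec z).re) / Fintype.card n ∂gaussian n := by
  rw [hiddenMeasure, integral_withDensity_eq_integral_toReal_smul (by fun_prop)
    (Filter.Eventually.of_forall fun z => ENNReal.ofReal_lt_top)]
  refine integral_congr_ae (Filter.Eventually.of_forall fun z => ?_)
  simp only
  rw [ENNReal.toReal_ofReal (by positivity), ← sum_norm_sq_mul_prob_pureState, smul_eq_mul]
  ring

theorem hasLocalHiddenStateModel_isotropic (d : ℕ) (hd : 2 ≤ d) {s η : ℝ} (h1 : s ≤ 1)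
    (h2 : 0 ≤ 1 + s * (d - 1)) (hs : s * (harmonic d - 1) = η * (d - 1))
    (M : Set (Observable (Fin d))) : HasLocalHiddenStateModel.{u} M (isotropic d η) := by
  refine HasLocalHiddenStateModel.ulift ?_
  have : Nontrivial (Fin d) := Fin.nontrivial_iff_two_le.2 hd
  choose U hU l hA using fun A : Observable (Fin d) => A.exists_diagonalization
  have hsum : ∀ (A : Observable (Fin d)) (z : Fin d → ℂ), ∑ a ∈ A.outcomes,
      ∑ i with l A i = a, response s ((U A).transpose.mulVec z) i = 1 := fun A z => by
    rw [Finset.sum_fiberwise_of_maps_to, sum_response]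
    intro i _
    rw [A.outcomes_eq (hU A) (hA A)]
    exact Finset.mem_image_of_mem _ (Finset.mem_univ i)
  -- Alice draws an index `i` from `response` at `Uᵀ z` and reports the eigenvalue `l A i`; for a
  -- degenerate eigenvalue the probabilities of its indices add up.
  refine ⟨Fin d → ℂ, inferInstance, hiddenMeasure (Fin d), pureState, fun A a z =>
    ∑ i with l A i = a, response s ((U A).transpose.mulVec z) i,
    isProbabilityMeasure_hiddenMeasure, isState_pureState, measurable_pureState,
    fun A _ a _ => Finset.measurable_sum _ fun i _ =>
      (measurable_response s i).comp (measurable_mulVec _),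
    fun A _ a _ z => Finset.sum_nonneg fun i _ => response_nonneg h1 (by simpa using h2) _ _,
    fun A _ z => hsum A z, fun A _ B a _ b _ => ?_⟩
  have hV := transpose_mem_unitaryGroup (hU A)
  have key := fun i => integral_response_unitary_mul_quadratic (n := Fin d) (s := s) (η := η)
    (by simpa using hs) i hV (B.projector b)
  have hre : ∫ z, (∑ i with l A i = a, response s ((U A).transpose.mulVec z) i) *
      (star z ⬝ᵥ (B.projector b).mulVec z).re ∂gaussian (Fin d) =
      (∑ i with l A i = a, ((((1 - η) / d : ℝ) : ℂ) * (B.projector b).trace +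
        η * ((U A).transpose * B.projector b * star (U A).transpose) i i)).re := by
    rw [Complex.re_sum]
    simp_rw [Finset.sum_mul]
    rw [integral_finsetSum]
    · refine Finset.sum_congr rfl fun i _ => ?_
      have := integral_re (key i).1
      rw [(key i).2] at this
      simpa using this
    · intro i _
      have := (key i).1.re
      simpa using this
  rw [integral_hiddenMeasure_mul_prob, integral_div, hre, jointProb_isotropic,
    A.projector_eq (hU A) (hA A), trace_transpose_mul_eq_sum, trace_unitary_conj_diagonal (hU A),
    Fintype.card_fin]
  have hd0 : (d : ℂ) ≠ 0 := by
    have : d ≠ 0 := by omega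
    exact_mod_cast this
  rw [← Complex.div_ofReal_re]
  congr 1
  simp only [Finset.sum_filter, ite_mul, one_mul, zero_mul]
  rw [Finset.sum_mul, Finset.mul_sum, Finset.mul_sum, ← Finset.sum_add_distrib, Finset.sum_div]
  refine Finset.sum_congr rfl fun i _ => ?_
  split_ifs
  · push_cast
    field_simp
  · simp

end Steering

/-! ### Haar averaging and the bound on every local hidden state model -/

namespace Steering

variable {n : Type} [Fintype n] [DecidableEq n]

noncomputable instance : MeasurableSpace (Matrix.unitaryGroup n ℂ) := borel _

instance : BorelSpace (Matrix.unitaryGroup n ℂ) := ⟨rfl⟩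

instance : CompactSpace (Matrix.unitaryGroup n ℂ) := by
  refine isCompact_iff_compactSpace.1 ?_
  have hb : IsCompact (Set.univ.pi fun _ : n => Set.univ.pi fun _ : n =>
      Metric.closedBall (0 : ℂ) 1) :=
    isCompact_univ_pi fun _ => isCompact_univ_pi fun _ => isCompact_closedBall 0 1
  have hc : IsClosed (Matrix.unitaryGroup n ℂ : Set (Matrix n n ℂ)) := isClosed_unitary
  refine IsCompact.of_isClosed_subset (X := n → n → ℂ) hb hc fun U hU i _ j _ => ?_
  simpa using entry_norm_bound_of_unitary hU i j

/-- The normalized Haar measure of the unitary group. -/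
noncomputable def unitaryHaar (n : Type) [Fintype n] [DecidableEq n] :
    Measure (Matrix.unitaryGroup n ℂ) :=
  Measure.haarMeasure ⊤

instance : IsProbabilityMeasure (unitaryHaar n) :=
  ⟨Measure.haarMeasure_self (K₀ := (⊤ : TopologicalSpace.PositiveCompacts _))⟩

instance : (unitaryHaar n).IsMulLeftInvariant := by
  unfold unitaryHaar; infer_instance

theorem measurable_unitary_apply (i j : n) :
    Measurable fun U : Matrix.unitaryGroup n ℂ => (U : Matrix n n ℂ) i j :=
  (Continuous.matrix_elem continuous_subtype_val i j).measurable

theorem measurable_star_unitary_apply (i j : n) :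
    Measurable fun U : Matrix.unitaryGroup n ℂ => star ((U : Matrix n n ℂ) i j) :=
  (continuous_star.comp (Continuous.matrix_elem continuous_subtype_val i j)).measurable

theorem measurable_maxNormSq_star_mulVec :
    Measurable fun x : (n → ℂ) × Matrix.unitaryGroup n ℂ =>
      maxNormSq ((star (x.2 : Matrix n n ℂ)).mulVec x.1) := by
  refine measurable_maxNormSq.comp (measurable_pi_lambda _ fun i => ?_)
  simp only [Matrix.mulVec, dotProduct, Matrix.star_apply]
  exact Finset.measurable_sum _ fun j _ =>
    ((measurable_star_unitary_apply j i).comp measurable_snd).mul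
      ((measurable_pi_apply j).comp measurable_fst)

theorem maxNormSq_star_mulVec_le {U : Matrix n n ℂ} (hU : U ∈ Matrix.unitaryGroup n ℂ)
    (z : n → ℂ) : maxNormSq ((star U).mulVec z) ≤ ∑ i, ‖z i‖ ^ 2 := by
  rw [← sum_norm_sq_unitary_mulVec (Unitary.star_mem hU) z]
  exact maxNormSq_le_sum _

theorem integrable_maxNormSq_star_mulVec (z : n → ℂ) :
    Integrable (fun U : Matrix.unitaryGroup n ℂ =>
      maxNormSq ((star (U : Matrix n n ℂ)).mulVec z)) (unitaryHaar n) := by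
  refine (integrable_const (∑ i, ‖z i‖ ^ 2)).mono'
    (measurable_maxNormSq_star_mulVec.comp measurable_prodMk_left).aestronglyMeasurable
    (Filter.Eventually.of_forall fun U => ?_)
  rw [Real.norm_of_nonneg (maxNormSq_nonneg _)]
  exact maxNormSq_star_mulVec_le U.2 z

theorem integral_maxNormSq_star_mulVec_unitary {V : Matrix n n ℂ}
    (hV : V ∈ Matrix.unitaryGroup n ℂ) (z : n → ℂ) :
    ∫ U : Matrix.unitaryGroup n ℂ, maxNormSq ((star (U : Matrix n n ℂ)).mulVec (V.mulVec z))
      ∂unitaryHaar n =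
    ∫ U : Matrix.unitaryGroup n ℂ, maxNormSq ((star (U : Matrix n n ℂ)).mulVec z)
      ∂unitaryHaar n := by
  rw [← integral_mul_left_eq_self _ (⟨V, hV⟩ : Matrix.unitaryGroup n ℂ)]
  refine integral_congr_ae (Filter.Eventually.of_forall fun U => ?_)
  simp only [Submonoid.coe_mul, star_mul]
  rw [Matrix.mulVec_mulVec, mul_assoc, Matrix.mem_unitaryGroup_iff'.1 hV, mul_one]

theorem maxNormSq_smul {m : Type} (c : ℂ) (z : m → ℂ) :
    maxNormSq (c • z) = ‖c‖ ^ 2 * maxNormSq z := by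
  unfold maxNormSq
  rw [Real.mul_iSup_of_nonneg (by positivity)]
  simp [mul_pow]

/-- Transitivity of the unitary group on spheres: extend the normalized `z` to an orthonormal basis.
-/
theorem exists_unitary_mulVec_single (z : n → ℂ) (k : n) :
    ∃ V ∈ Matrix.unitaryGroup n ℂ,
      z = (√(∑ i, ‖z i‖ ^ 2) : ℂ) • V.mulVec (Pi.single k 1) := by
  by_cases hz : z = 0
  · exact ⟨1, one_mem _, by simp [hz]⟩
  have hN := sum_norm_sq_pos hz
  set x : EuclideanSpace ℂ n := WithLp.toLp 2 z with hx
  have hxn : ‖x‖ = √(∑ i, ‖z i‖ ^ 2) := EuclideanSpace.norm_eq x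
  have hpos : 0 < ‖x‖ := hxn ▸ Real.sqrt_pos.2 hN
  have ho : Orthonormal ℂ (({k} : Set n).domRestrict fun _ => ((‖x‖ : ℂ)⁻¹) • x) := by
    refine ⟨fun _ => ?_, fun i j hij => (hij (Subsingleton.elim i j)).elim⟩
    change ‖((‖x‖ : ℂ)⁻¹) • x‖ = 1
    simp [norm_smul, hpos.ne']
  obtain ⟨b, hb⟩ := ho.exists_orthonormalBasis_extension_of_card_eq (by simp)
  refine ⟨_, (EuclideanSpace.basisFun n ℂ).toMatrix_orthonormalBasis_mem_unitary b, ?_⟩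
  funext i
  have hbk := congrArg (fun y : EuclideanSpace ℂ n => y i) (hb k rfl)
  rw [Matrix.mulVec_single_one, ← hxn]
  have : (‖x‖ : ℂ) ≠ 0 := by exact_mod_cast hpos.ne'
  have hx' : z i = x i := rfl
  rw [PiLp.smul_apply, smul_eq_mul] at hbk
  simp only [Pi.smul_apply, smul_eq_mul, Matrix.col_apply, Module.Basis.toMatrix_apply,
    OrthonormalBasis.coe_toBasis_repr_apply,
    EuclideanSpace.basisFun_repr]
  rw [hbk, mul_inv_cancel_left₀ this, hx']

/-- Invariance, transitivity and homogeneity give `c ‖z‖²` with `c` independent of `z`. Averaging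
over Gaussian `z` as well finds `c`: one order of integration gives `c d`, the other gives `H_d`,
since the Gaussian integral is the same for every `U`. -/
theorem integral_maxNormSq_star_mulVec [Nonempty n] (z : n → ℂ) :
    ∫ U : Matrix.unitaryGroup n ℂ, maxNormSq ((star (U : Matrix n n ℂ)).mulVec z)
      ∂unitaryHaar n = harmonic (Fintype.card n) / Fintype.card n * ∑ i, ‖z i‖ ^ 2 := by
  obtain ⟨k⟩ := ‹Nonempty n›
  set c := ∫ U : Matrix.unitaryGroup n ℂ,
    maxNormSq ((star (U : Matrix n n ℂ)).mulVec (Pi.single k 1)) ∂unitaryHaar n with hc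
  have h : ∀ z : n → ℂ, ∫ U : Matrix.unitaryGroup n ℂ,
      maxNormSq ((star (U : Matrix n n ℂ)).mulVec z) ∂unitaryHaar n = c * ∑ i, ‖z i‖ ^ 2 := by
    intro z
    obtain ⟨V, hV, hz⟩ := exists_unitary_mulVec_single z k
    conv_lhs => rw [hz]
    simp_rw [Matrix.mulVec_smul, maxNormSq_smul]
    rw [integral_const_mul, integral_maxNormSq_star_mulVec_unitary hV, ← hc, Complex.norm_real,
      Real.norm_of_nonneg (Real.sqrt_nonneg _), Real.sq_sqrt (by positivity), mul_comm]
  have hF := integral_integral_swap (μ := gaussian n) (ν := unitaryHaar n)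
    (f := fun z U => maxNormSq ((star (U : Matrix n n ℂ)).mulVec z))
    ((integrable_sum_norm_sq_gaussian.comp_fst (unitaryHaar n)).mono'
      measurable_maxNormSq_star_mulVec.aestronglyMeasurable
      (Filter.Eventually.of_forall fun x => by
        rw [Function.uncurry, Real.norm_of_nonneg (maxNormSq_nonneg _)]
        exact maxNormSq_star_mulVec_le x.2.2 x.1))
  have hR : ∀ U : Matrix.unitaryGroup n ℂ,
      ∫ z, maxNormSq ((star (U : Matrix n n ℂ)).mulVec z) ∂gaussian n =
        harmonic (Fintype.card n) := fun U => by
    have : Nonempty n := ⟨k⟩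
    rw [integral_gaussian_unitary_mulVec (Unitary.star_mem U.2) maxNormSq, integral_maxNormSq]
  simp_rw [h, hR] at hF
  rw [integral_const_mul, integral_sum_norm_sq_gaussian, integral_const, probReal_univ,
    one_smul] at hF
  have hn : (Fintype.card n : ℝ) ≠ 0 := by
    have : Nonempty n := ⟨k⟩
    exact_mod_cast Fintype.card_ne_zero
  rw [h, ← hF, mul_div_cancel_right₀ _ hn]

/-- The largest of the probabilities of the outcomes of the measurement, in the state `ρ`, of the
orthonormal basis formed by the columns of `U`. -/
noncomputable def maxOutcomeProb (U ρ : Matrix n n ℂ) : ℝ := ⨆ i, ((star U * ρ * U) i i).re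

theorem re_conj_le_maxOutcomeProb {m : Type} [Fintype m] (U ρ : Matrix m m ℂ) (i : m) :
    ((star U * ρ * U) i i).re ≤ maxOutcomeProb U ρ :=
  le_ciSup (f := fun i => ((star U * ρ * U) i i).re) (Set.finite_range _).bddAbove i

theorem re_conj_nonneg {m : Type} [Fintype m] {ρ : Matrix m m ℂ} (hρ : IsState ρ)
    (U : Matrix m m ℂ) (i : m) :
    0 ≤ ((star U * ρ * U) i i).re :=
  (Complex.le_def.1 (hρ.1.conjTranspose_mul_mul_same U).diag_nonneg).1

theorem re_conj_le_one {ρ : Matrix n n ℂ} (hρ : IsState ρ) {U : Matrix n n ℂ}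
    (hU : U ∈ Matrix.unitaryGroup n ℂ) (i : n) : ((star U * ρ * U) i i).re ≤ 1 := by
  have h : (star U * ρ * U).trace = 1 := by
    rw [Matrix.trace_mul_comm, ← mul_assoc, Matrix.mem_unitaryGroup_iff.1 hU, one_mul, hρ.2]
  have h2 := congrArg Complex.re h
  rw [Matrix.trace, Complex.re_sum, Complex.one_re] at h2
  rw [← h2]
  exact Finset.single_le_sum (f := fun i => ((star U * ρ * U) i i).re)
    (fun j _ => re_conj_nonneg hρ U j) (Finset.mem_univ i)

theorem maxOutcomeProb_nonneg {m : Type} [Fintype m] {ρ : Matrix m m ℂ} (hρ : IsState ρ)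
    (U : Matrix m m ℂ) :
    0 ≤ maxOutcomeProb U ρ :=
  Real.iSup_nonneg fun i => re_conj_nonneg hρ U i

theorem maxOutcomeProb_le_one {ρ : Matrix n n ℂ} (hρ : IsState ρ) {U : Matrix n n ℂ}
    (hU : U ∈ Matrix.unitaryGroup n ℂ) : maxOutcomeProb U ρ ≤ 1 :=
  Real.iSup_le (fun i => re_conj_le_one hρ hU i) zero_le_one

theorem measurable_maxOutcomeProb {m : Type} [Fintype m] {X : Type*} [MeasurableSpace X]
    {U ρ : X → Matrix m m ℂ} (hU : ∀ i j, Measurable fun x => U x i j)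
    (hρ : ∀ i j, Measurable fun x => ρ x i j) :
    Measurable fun x => maxOutcomeProb (U x) (ρ x) := by
  refine Measurable.iSup fun i => Complex.measurable_re.comp ?_
  simp only [Matrix.mul_apply, Matrix.star_apply]
  exact Finset.measurable_sum _ fun j _ => (Finset.measurable_sum _ fun k _ =>
    (continuous_star.measurable.comp (hU k i)).mul (hρ k j)).mul (hU j i)

/-- A state is a convex combination of its eigenprojections, and a maximum is convex, so pure states
are the worst case; for these the mean is exactly `H_d / d`. -/
theorem integral_maxOutcomeProb_le [Nonempty n] {ρ : Matrix n n ℂ} (hρ : IsState ρ) :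
    ∫ U : Matrix.unitaryGroup n ℂ, maxOutcomeProb (U : Matrix n n ℂ) ρ ∂unitaryHaar n ≤
      harmonic (Fintype.card n) / Fintype.card n := by
  set V : Matrix n n ℂ := hρ.1.1.eigenvectorUnitary.1 with hV
  have hVu : V ∈ Matrix.unitaryGroup n ℂ := hρ.1.1.eigenvectorUnitary.2
  set p := hρ.1.1.eigenvalues with hp
  have hp0 : ∀ k, 0 ≤ p k := hρ.1.eigenvalues_nonneg
  have hp1 : ∑ k, p k = 1 := by
    have := hρ.1.1.trace_eq_sum_eigenvalues.symm.trans hρ.2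
    rw [← RCLike.ofReal_sum] at this
    exact RCLike.ofReal_inj.1 (this.trans RCLike.ofReal_one.symm)
  have hρV : ρ = V * Matrix.diagonal (fun k => (p k : ℂ)) * star V := by
    conv_lhs => rw [hρ.1.1.spectral_theorem, Unitary.conjStarAlgAut_apply]
    rfl
  have hle : ∀ U : Matrix.unitaryGroup n ℂ, maxOutcomeProb (U : Matrix n n ℂ) ρ ≤
      ∑ k, p k * maxNormSq ((star (U : Matrix n n ℂ)).mulVec fun i => V i k) := by
    intro U
    refine ciSup_le fun i => ?_
    have e : ((star (U : Matrix n n ℂ) * ρ * U) i i).re =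
        ∑ k, p k * ‖((star (U : Matrix n n ℂ)).mulVec fun i => V i k) i‖ ^ 2 := by
      have e1 : star (U : Matrix n n ℂ) * ρ * U = (star (U : Matrix n n ℂ) * V) *
          Matrix.diagonal (fun k => (p k : ℂ)) * star (star (U : Matrix n n ℂ) * V) := by
        rw [hρV]
        simp only [star_mul, star_star, mul_assoc]
      rw [e1, Matrix.mul_apply, Complex.re_sum]
      refine Finset.sum_congr rfl fun k _ => ?_
      rw [Matrix.mul_diagonal, Matrix.star_apply, mul_right_comm, Complex.star_def,
        Complex.mul_conj', mul_comm, ← Complex.ofReal_pow, ← Complex.ofReal_mul,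
        Complex.ofReal_re]
      rfl
    rw [e]
    exact Finset.sum_le_sum fun k _ =>
      mul_le_mul_of_nonneg_left (norm_sq_le_maxNormSq _ i) (hp0 k)
  have hm : Measurable fun U : Matrix.unitaryGroup n ℂ =>
      maxOutcomeProb (U : Matrix n n ℂ) ρ :=
    measurable_maxOutcomeProb measurable_unitary_apply fun _ _ => measurable_const
  have hint : Integrable (fun U : Matrix.unitaryGroup n ℂ =>
      maxOutcomeProb (U : Matrix n n ℂ) ρ) (unitaryHaar n) :=
    (integrable_const (1 : ℝ)).mono' hm.aestronglyMeasurable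
      (Filter.Eventually.of_forall fun U => by
        rw [Real.norm_of_nonneg (maxOutcomeProb_nonneg hρ _)]
        exact maxOutcomeProb_le_one hρ U.2)
  have hint2 := fun k => (integrable_maxNormSq_star_mulVec fun i => V i k).const_mul (p k)
  refine (integral_mono hint (integrable_finsetSum _ fun k _ => hint2 k) hle).trans_eq ?_
  have hcol : ∀ k, ∑ i, ‖V i k‖ ^ 2 = 1 := fun k => by
    have := sum_norm_sq_unitary_mulVec hVu (Pi.single k 1)
    rw [Matrix.mulVec_single_one] at this
    refine this.trans ?_
    rw [Finset.sum_eq_single k (fun j _ hj => by simp [hj]) (by simp)]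
    simp
  rw [integral_finsetSum _ fun k _ => hint2 k]
  simp_rw [integral_const_mul, integral_maxNormSq_star_mulVec, hcol]
  rw [mul_one, ← Finset.sum_mul, hp1, one_mul]

/-- `(star U).transpose` is the entrywise conjugate of `U`, so the transposes of Alice's projectors
are Bob's and `ψ₊` correlates the outcomes perfectly. -/
theorem jointProb_unitaryObservable_isotropic (d : ℕ) (η : ℝ)
    {U : Matrix (Fin d) (Fin d) ℂ} (hU : U ∈ Matrix.unitaryGroup (Fin d) ℂ) {l : Fin d → ℝ}
    (hl : Function.Injective l) (i : Fin d) :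
    jointProb (unitaryObservable (star U).transpose l) (unitaryObservable U l) (l i) (l i)
      (isotropic d η) = (1 - η) / (d : ℝ) ^ 2 + η / d := by
  have hU' := transpose_mem_unitaryGroup (Unitary.star_mem hU)
  have hU1 : star U * U = 1 := Matrix.mem_unitaryGroup_iff'.1 hU
  rw [jointProb_isotropic, Observable.projector_eq _ hU' rfl, Observable.projector_eq _ hU rfl,
    trace_transpose_mul_eq_sum, trace_unitary_conj_diagonal hU', trace_unitary_conj_diagonal hU]
  simp only [hl.eq_iff, Finset.sum_ite_eq', Finset.mem_univ, if_true, mul_one, ite_mul,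
    one_mul, zero_mul, Matrix.transpose_transpose, star_star]
  have e : star U * (U * Matrix.diagonal (fun j => if j = i then (1 : ℂ) else 0) * star U) * U =
      Matrix.diagonal (fun j => if j = i then (1 : ℂ) else 0) := by
    simp only [mul_assoc, hU1, mul_one]
    rw [← mul_assoc, hU1, one_mul]
  rw [e, Matrix.diagonal_apply_eq, if_pos rfl, mul_one, ← Complex.ofReal_add, Complex.ofReal_re]

theorem prob_unitaryObservable {U : Matrix n n ℂ} (hU : U ∈ Matrix.unitaryGroup n ℂ) {l : n → ℝ}
    (hl : Function.Injective l) (ρ : Matrix n n ℂ) (i : n) :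
    prob (unitaryObservable U l) (l i) ρ = ((star U * ρ * U) i i).re := by
  rw [prob, Observable.projector_eq _ hU rfl, mul_assoc, mul_assoc, Matrix.trace_mul_comm,
    mul_assoc]
  simp [Matrix.trace, Matrix.diagonal_mul, hl.eq_iff]

/-- The left side is the probability that the two outcomes agree. Given `ξ`, this is an average of
Bob's outcome probabilities with Alice's responses as weights, hence at most the largest of them. -/
theorem le_integral_maxOutcomeProb (d : ℕ) (hd : d ≠ 0) {η : ℝ} {Ξ : Type*} [MeasurableSpace Ξ]
    {μ : Measure Ξ} [IsProbabilityMeasure μ] {ρ : Ξ → Matrix (Fin d) (Fin d) ℂ}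
    (hρ : ∀ ξ, IsState (ρ ξ)) (hρm : ∀ i j, Measurable fun ξ => ρ ξ i j)
    {p : Observable (Fin d) → ℝ → Ξ → ℝ}
    (hpm : ∀ A, ∀ a ∈ A.outcomes, Measurable (p A a))
    (hp0 : ∀ A, ∀ a ∈ A.outcomes, ∀ ξ, 0 ≤ p A a ξ)
    (hp1 : ∀ A : Observable (Fin d), ∀ ξ, ∑ a ∈ A.outcomes, p A a ξ = 1)
    (hW : ∀ A B : Observable (Fin d), ∀ a ∈ A.outcomes, ∀ b ∈ B.outcomes,
      jointProb A B a b (isotropic d η) = ∫ ξ, p A a ξ * prob B b (ρ ξ) ∂μ)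
    {U : Matrix (Fin d) (Fin d) ℂ} (hU : U ∈ Matrix.unitaryGroup (Fin d) ℂ) :
    (1 + η * (d - 1)) / d ≤ ∫ ξ, maxOutcomeProb U (ρ ξ) ∂μ := by
  -- Any distinct eigenvalues serve: the outcomes then label the basis vectors and all projectors
  -- have rank one.
  obtain ⟨l, hl⟩ : ∃ l : Fin d → ℝ, Function.Injective l :=
    ⟨fun i => (i : ℕ), fun i j hij => Fin.ext (Nat.cast_injective (R := ℝ) hij)⟩
  have hAo := (unitaryObservable (star U).transpose l).outcomes_eq
    (transpose_mem_unitaryGroup (Unitary.star_mem hU)) rfl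
  have hBo := (unitaryObservable U l).outcomes_eq hU rfl
  have hjoint := jointProb_unitaryObservable_isotropic d η hU hl
  have hprob := fun i ξ => prob_unitaryObservable hU hl (ρ ξ) i
  generalize unitaryObservable (star U).transpose l = A at hAo hjoint
  generalize unitaryObservable U l = B at hBo hjoint hprob
  have hmemA : ∀ i, l i ∈ A.outcomes := fun i => by
    rw [hAo]; exact Finset.mem_image_of_mem _ (Finset.mem_univ i)
  have hmemB : ∀ i, l i ∈ B.outcomes := fun i => by
    rw [hBo]; exact Finset.mem_image_of_mem _ (Finset.mem_univ i)
  have hs : ∀ ξ, ∑ i, p A (l i) ξ = 1 := fun ξ => by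
    rw [← hp1 A ξ, hAo, Finset.sum_image fun i _ j _ hij => hl hij]
  have hpm' : ∀ i, Measurable fun ξ => prob B (l i) (ρ ξ) := fun i => by
    simp_rw [hprob, Matrix.mul_apply]
    fun_prop
  have hpint : ∀ i, Integrable (fun ξ => p A (l i) ξ * prob B (l i) (ρ ξ)) μ := fun i => by
    refine (integrable_const (1 : ℝ)).mono'
      ((hpm A _ (hmemA i)).mul (hpm' i)).aestronglyMeasurable
      (Filter.Eventually.of_forall fun ξ => ?_)
    have h0 := fun j => hp0 A _ (hmemA j) ξ
    have h1 : p A (l i) ξ ≤ 1 := by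
      rw [← hs ξ]
      exact Finset.single_le_sum (f := fun i => p A (l i) ξ) (fun j _ => h0 j)
        (Finset.mem_univ i)
    have h2 := re_conj_nonneg (hρ ξ) U i
    rw [hprob, Real.norm_of_nonneg (mul_nonneg (h0 i) h2)]
    exact mul_le_one₀ h1 h2 (re_conj_le_one (hρ ξ) hU i)
  have hd' : (d : ℝ) ≠ 0 := by exact_mod_cast hd
  have hsum : (1 + η * (d - 1)) / d = ∫ ξ, ∑ i, p A (l i) ξ * prob B (l i) (ρ ξ) ∂μ := by
    rw [integral_finsetSum _ fun i _ => hpint i, Finset.sum_congr rfl fun i _ =>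
      (hW A B _ (hmemA i) _ (hmemB i)).symm.trans (hjoint i)]
    simp
    field_simp
    ring
  have hm : Measurable fun ξ => maxOutcomeProb U (ρ ξ) :=
    measurable_maxOutcomeProb (U := fun _ => U) (fun i j => measurable_const) hρm
  have hint : Integrable (fun ξ => maxOutcomeProb U (ρ ξ)) μ :=
    (integrable_const (1 : ℝ)).mono'
      hm.aestronglyMeasurable
      (Filter.Eventually.of_forall fun ξ => by
        rw [Real.norm_of_nonneg (maxOutcomeProb_nonneg (hρ _) _)]
        exact maxOutcomeProb_le_one (hρ _) hU)
  have hle : ∀ ξ, ∑ i, p A (l i) ξ * prob B (l i) (ρ ξ) ≤ maxOutcomeProb U (ρ ξ) := fun ξ =>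
    calc ∑ i, p A (l i) ξ * prob B (l i) (ρ ξ)
        ≤ ∑ i, p A (l i) ξ * maxOutcomeProb U (ρ ξ) :=
          Finset.sum_le_sum fun i _ => mul_le_mul_of_nonneg_left
            (hprob i ξ ▸ re_conj_le_maxOutcomeProb _ _ i) (hp0 A _ (hmemA i) ξ)
      _ = maxOutcomeProb U (ρ ξ) := by rw [← Finset.sum_mul, hs, one_mul]
  rw [hsum]
  exact integral_mono (integrable_finsetSum _ fun i _ => hpint i) hint hle

theorem one_add_mul_le_of_hasLocalHiddenStateModel (d : ℕ) (hd : d ≠ 0) {η : ℝ}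
    (h : HasLocalHiddenStateModel.{u} Set.univ (isotropic d η)) :
    1 + η * (d - 1) ≤ harmonic d := by
  obtain ⟨Ξ, _, μ, ρ, p, hμ, hρ, hρm, hpm, hp0, hp1, hW⟩ := h
  have : Nonempty (Fin d) := ⟨⟨0, Nat.pos_of_ne_zero hd⟩⟩
  let f : Matrix.unitaryGroup (Fin d) ℂ → Ξ → ℝ := fun U ξ =>
    maxOutcomeProb (U : Matrix (Fin d) (Fin d) ℂ) (ρ ξ)
  have hint : Integrable (Function.uncurry f) ((unitaryHaar (Fin d)).prod μ) :=
    (integrable_const (1 : ℝ)).mono' (measurable_maxOutcomeProb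
      (fun i j => (measurable_unitary_apply i j).comp measurable_fst)
      (fun i j => (hρm i j).comp measurable_snd)).aestronglyMeasurable
      (Filter.Eventually.of_forall fun x => by
        simp only [Function.uncurry, f]
        rw [Real.norm_of_nonneg (maxOutcomeProb_nonneg (hρ _) _)]
        exact maxOutcomeProb_le_one (hρ _) x.1.2)
  have key : ∀ U, (1 + η * (d - 1)) / d ≤ ∫ ξ, f U ξ ∂μ := fun U =>
    le_integral_maxOutcomeProb d hd hρ hρm (fun A => hpm A trivial) (fun A => hp0 A trivial)
      (fun A => hp1 A trivial) (fun A => hW A trivial) U.2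
  have h1 : (1 + η * (d - 1)) / d ≤ ∫ U, ∫ ξ, f U ξ ∂μ ∂unitaryHaar (Fin d) := by
    simpa using integral_mono (integrable_const _) hint.integral_prod_left key
  have h2 : ∫ ξ, ∫ U, f U ξ ∂unitaryHaar (Fin d) ∂μ ≤ harmonic d / d := by
    have h3 : ∀ ξ, ∫ U, f U ξ ∂unitaryHaar (Fin d) ≤ harmonic d / d := fun ξ => by
      simpa using integral_maxOutcomeProb_le (hρ ξ)
    simpa using integral_mono hint.integral_prod_right (integrable_const _) h3
  rw [integral_integral_swap hint] at h1
  have hd' : (0 : ℝ) < d := by positivity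
  exact (div_le_div_iff_of_pos_right hd').1 (h1.trans h2)

/-- For `d ≥ 2` this says `-(H_d - 1) / (d - 1)² ≤ -1 / (d² - 1)`: the least `η` the model reaches
is no larger than the least for which the matrix is a state. It also yields `H_d > 1`. -/
theorem two_mul_le_succ_mul_harmonic (d : ℕ) : 2 * (d : ℝ) ≤ (d + 1) * harmonic d := by
  induction d with
  | zero => simp
  | succ k ih =>
    rw [harmonic_succ]
    push_cast
    have hk : (0 : ℝ) < k + 1 := by positivity
    have h : (0 : ℝ) ≤ k := by positivity
    have e : ((k : ℝ) + 1 + 1) * (harmonic k + (k + 1 : ℝ)⁻¹) * (k + 1) =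
        (k + 2) * ((k + 1) * harmonic k) + (k + 2) := by
      field_simp
      ring
    refine le_of_mul_le_mul_right ?_ hk
    rw [e]
    nlinarith [mul_le_mul_of_nonneg_left ih (by positivity : (0 : ℝ) ≤ k + 2)]

end Steering

/-- For `d ≥ 2` and every `η` for which the isotropic matrix is a state, it is steerable by Alice
iff `η > (H_d - 1) / (d - 1)`. -/
theorem mainTheorem2 (d : ℕ) (hd : 2 ≤ d) (η : ℝ) (hW : Steering.IsState (Steering.isotropic d η)) :
    Steering.SteerableByAlice.{u} (Steering.isotropic d η) ↔
      ((harmonic d : ℝ) - 1) / ((d : ℝ) - 1) < η := by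
  have hd0 : d ≠ 0 := by omega
  have hd1 : (0 : ℝ) < d - 1 := by
    have : (2 : ℝ) ≤ d := by exact_mod_cast hd
    linarith
  have hη := Steering.one_add_mul_nonneg_of_isState_isotropic d hd0 η hW
  have hH := Steering.two_mul_le_succ_mul_harmonic d
  have hH1 : (0 : ℝ) < harmonic d - 1 := by nlinarith
  rw [div_lt_iff₀ hd1]
  constructor
  · rintro ⟨M, hM⟩
    by_contra! h
    -- `s` is the ratio of `η` to the critical value, so `s ≤ 1` is the assumption `h`.
    refine hM (Steering.hasLocalHiddenStateModel_isotropic d hd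
      (s := η * (d - 1) / (harmonic d - 1)) ((div_le_one hH1).2 h) ?_
      (div_mul_cancel₀ _ hH1.ne') M)
    have e : 1 + η * ((d : ℝ) - 1) / (harmonic d - 1) * (d - 1) =
        ((harmonic d - 1) + η * (d - 1) ^ 2) / (harmonic d - 1) := by
      field_simp
    rw [e]
    refine div_nonneg ?_ hH1.le
    have h1 : 0 ≤ ((d : ℝ) - 1) * (1 + η * (d ^ 2 - 1)) := mul_nonneg hd1.le hη
    -- By `hH`, `(d + 1)(H_d - 1) ≥ d - 1`, so the product is at least the quantity in `h1`.
    have h2 : 0 ≤ ((d : ℝ) + 1) * (harmonic d - 1 + η * (d - 1) ^ 2) := by nlinarith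
    exact nonneg_of_mul_nonneg_right h2 (by linarith)
  · intro h
    refine ⟨Set.univ, fun hM => ?_⟩
    have := Steering.one_add_mul_le_of_hasLocalHiddenStateModel d hd0 hM
    linarith
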